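/- **Setting.** Let $(X_i,Z_i)_{i\ge 1}$ be i.i.d. random vectors in $\mathbb R^2\times\mathbb R^p$ with joint density $f_{X,Z}\ge 0$. Put $f_Z(z)=\int f_{X,Z}(x,z)\,dx$, and for $f_Z(z)>0$ let $\tau(z)$ be the conditional Kendall's tau $$\tau(z)=\mathbb P\big((U_1-V_1)(U_2-V_2)>0\big)-\mathbb P\big((U_1-V_1)(U_2-V_2)<0\big),$$ where $U,V$ are independent with density $x\mapsto f_{X,Z}(x,z)/f_Z(z)$. Let $\mathcal Z\subset\mathbb R^p$ be compact. Let $g$ be one of $g_1(x,y)=4\cdot\mathbf 1\{x_1<y_1,x_2<y_2\}-1$, $g_2(x,y)=\mathbf 1\{(x_1-y_1)(x_2-y_2)>0\}-\mathbf 1\{(x_1-y_1)(x_2-y_2)<0\}$, $g_3(x,y)=1-4\cdot\mathbf 1\{x_1<y_1,x_2>y_2\}$. For a kernel $K:\mathbb R^p\to\mathbb R$ and a bandwidth $h>0$ put $K_h(u)=h^{-p}K(u/h)$ and $$\hat\tau_{n,h}(z)=\sum_{i,j=1}^n w_i(z)w_j(z)\,g(X_i,X_j),\qquad w_i(z)=\frac{K_h(Z_i-z)}{\sum_{j=1}^nK_h(Z_j-z)}$$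 (quotients with zero denominator are set to $0$). **Assumptions.** 1. $K$ is measurable, bounded, symmetric ($K(-u)=K(u)$), integrable, $\int K=1$, and of order $\alpha$ for an integer $\alpha\ge2$: for $1\le j<\alpha$ and all indices $i_1,\dots,i_j$, the function $K(u)u_{i_1}\cdots u_{i_j}$ is integrable with integral $0$. 2. $f_Z\in C^\alpha(\mathbb R^p)$, and $\displaystyle\sup_{z\in\mathcal Z}\int|K(u)|\sum_{i_1,\dots,i_\alpha=1}^p|u_{i_1}\cdots u_{i_\alpha}|\sup_{t\in[0,1]}\Big|\frac{\partial^\alpha f_Z}{\partial z_{i_1}\cdots\partial z_{i_\alpha}}(z+tu)\Big|\,du<\infty$. 3. There are constants with $0<f_{Z,\min}\le f_Z(z)\le f_{Z,\max}$ for all $z\in\mathcal Z$. 4. For every $x\in\mathbb R^2$, $z\mapsto f_{X,Z}(x,z)$ is of class $C^{\alpha-1}$ on $\mathbb R^p$ with locally Lipschitz derivatives of order $\alpha-1$ (hence it is differentiable almost everywhere up to the order $\alpha$), and, with $$\mathcal H_{k,\vec\iota}(u,v,x_1,x_2,z)=\sup_{t\in[0,1]}\Big|\frac{\partial^kf_{X,Z}}{\partial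 z_{i_1}\cdots\partial z_{i_k}}(x_1,z+tu)\,\frac{\partial^{\alpha-k}f_{X,Z}}{\partial z_{i_{k+1}}\cdots\partial z_{i_\alpha}}(x_2,z+tv)\Big|$$ (derivatives of order $\alpha$ being set to $0$ at the points where the derivative of order $\alpha-1$ is not differentiable), one has $$\sup_{z\in\mathcal Z}\int|K(u)||K(v)|\sum_{k=0}^\alpha\binom\alpha k\sum_{i_1,\dots,i_\alpha=1}^p\mathcal H_{k,\vec\iota}(u,v,x_1,x_2,z)\,|u_{i_1}\cdots u_{i_k}v_{i_{k+1}}\cdots v_{i_\alpha}|\,du\,dv\,dx_1\,dx_2<\infty.$$ 5. $\psi:\mathbb R^p\to\mathbb R^{p'}$ is bounded on $\mathcal Z$. The function $\Lambda$ is increasing (not necessarily strictly) and continuously differentiable on $(-1,1)$, and $\Lambda'$ is bounded on $U\cap(-1,1)$ for some open set $U\supseteq\tau(\mathcal Z)$; the values of $\Lambda$ outside $(-1,1)$ are arbitrary. 6. (Model) $\Lambda(\tau(z))=\psi(z)^T\beta^*$ for all $z\in\mathcal Z$, with $\beta^*\in\mathbb R^{p'}$. **Estimator.** Let $(z'_i)_{i\ge1}$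 be a deterministic sequence in $\mathcal Z$. For $h_{n,n'}>0$ and $\lambda_{n,n'}\ge0$ let $\hat\beta_{n,n'}$ be any minimizer over $\beta\in\mathbb R^{p'}$ of $$\frac1{n'}\sum_{i=1}^{n'}\big(\Lambda(\hat\tau_{n,h_{n,n'}}(z'_i))-\psi(z'_i)^T\beta\big)^2+\lambda_{n,n'}|\beta|_1 .$$ **Theorem.** Suppose that $\frac1{n'}\sum_{i=1}^{n'}\psi(z'_i)\psi(z'_i)^T$ converges to a matrix $M$ as $n'\to\infty$. Let $(n,n')\to\infty$ in a prescribed way in which both indices tend to infinity (for instance along $n'=n'(n)\to\infty$ as $n\to\infty$; in general, along any filter on $\mathbb N^2$ for which $n\to\infty$ and $n'\to\infty$), and suppose that, in this limit, $h_{n,n'}\to0$, $\lambda_{n,n'}\to\lambda_0$, and $n'\exp(-A\,n\,h_{n,n'}^{2p})\to0$ for every $A>0$. Put $$\mathbb G_{\infty,\infty}(\beta)=(\beta^*-\beta)^TM(\beta^*-\beta)+\lambda_0|\beta|_1 .$$ If $\mathbb G_{\infty,\infty}$ has a unique minimizer $\arg\min_\beta\mathbb G_{\infty,\infty}(\beta)$,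 then, in the same limit, $$\hat\beta_{n,n'}\ \longrightarrow\ \arg\min_{\beta\in\mathbb R^{p'}}\mathbb G_{\infty,\infty}(\beta)\quad\text{in probability.}$$ Moreover, if $\lambda_0=0$ and $M$ is invertible, then $\hat\beta_{n,n'}\to\beta^*$ in probability. -/

import Mathlib

open MeasureTheory ProbabilityTheory Filter Topology Set
open scoped ENNReal Matrix

noncomputable section

namespace CondKendall

/-! ### The population: joint density, marginal density, conditional Kendall's tau

`f x z` is the joint density of `(X, Z)` at `x = (x₁, x₂) ∈ ℝ²`, `z ∈ ℝᵖ`. -/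

/-- The density of `Z`, as the marginal of the joint density. -/
def marginalZ {p : ℕ} (f : ℝ × ℝ → (Fin p → ℝ) → ℝ) (z : Fin p → ℝ) : ℝ :=
  ∫ x, f x z

/-- The conditional law of `X` given `Z = z`, with density `x ↦ f(x, z) / f_Z(z)`. -/
def condLaw {p : ℕ} (f : ℝ × ℝ → (Fin p → ℝ) → ℝ) (z : Fin p → ℝ) : Measure (ℝ × ℝ) :=
  volume.withDensity fun x => ENNReal.ofReal (f x z / marginalZ f z)

/-- The conditional Kendall's tau: probability of concordance minus probability of discordance
of two independent draws from the conditional law of `X` given `Z = z`. -/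
def condTau {p : ℕ} (f : ℝ × ℝ → (Fin p → ℝ) → ℝ) (z : Fin p → ℝ) : ℝ :=
  ((condLaw f z).prod (condLaw f z)).real
      {q | 0 < (q.1.1 - q.2.1) * (q.1.2 - q.2.2)}
    - ((condLaw f z).prod (condLaw f z)).real
      {q | (q.1.1 - q.2.1) * (q.1.2 - q.2.2) < 0}

/-! ### The kernel estimator of the conditional Kendall's tau -/

open Classical in
/-- `4 · 1{x₁ < y₁, x₂ < y₂} - 1`. -/
def g₁ (x y : ℝ × ℝ) : ℝ := 4 * (if x.1 < y.1 ∧ x.2 < y.2 then 1 else 0) - 1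

open Classical in
/-- `1{(x₁ - y₁)(x₂ - y₂) > 0} - 1{(x₁ - y₁)(x₂ - y₂) < 0}`. -/
def g₂ (x y : ℝ × ℝ) : ℝ :=
  (if 0 < (x.1 - y.1) * (x.2 - y.2) then 1 else 0)
    - (if (x.1 - y.1) * (x.2 - y.2) < 0 then 1 else 0)

open Classical in
/-- `1 - 4 · 1{x₁ < y₁, x₂ > y₂}`. -/
def g₃ (x y : ℝ × ℝ) : ℝ := 1 - 4 * (if x.1 < y.1 ∧ y.2 < x.2 then 1 else 0)

/-- The rescaled kernel `K_h(u) = h⁻ᵖ K(u / h)`. -/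
def scaledKernel {p : ℕ} (K : (Fin p → ℝ) → ℝ) (h : ℝ) (u : Fin p → ℝ) : ℝ :=
  (h ^ p)⁻¹ * K (h⁻¹ • u)

/-- The weight `w_{i,n}(z) = K_h(Z_i - z) / ∑_{j < n} K_h(Z_j - z)`. -/
def weight {p : ℕ} (K : (Fin p → ℝ) → ℝ) (h : ℝ) (n : ℕ) (Z : ℕ → Fin p → ℝ)
    (z : Fin p → ℝ) (i : ℕ) : ℝ :=
  scaledKernel K h (Z i - z) / ∑ j ∈ Finset.range n, scaledKernel K h (Z j - z)

/-- The estimator `∑_{i, j < n} w_{i,n}(z) w_{j,n}(z) g(X_i, X_j)` of the conditional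
Kendall's tau at `z`, computed from the first `n` observations. -/
def tauHat {p : ℕ} (g : ℝ × ℝ → ℝ × ℝ → ℝ) (K : (Fin p → ℝ) → ℝ) (h : ℝ) (n : ℕ)
    (X : ℕ → ℝ × ℝ) (Z : ℕ → Fin p → ℝ) (z : Fin p → ℝ) : ℝ :=
  ∑ i ∈ Finset.range n, ∑ j ∈ Finset.range n,
    weight K h n Z z i * weight K h n Z z j * g (X i) (X j)

/-! ### The penalized criterion, its limit, and the empirical Gram matrix -/

/-- The `ℓ¹` norm on `ℝ^{p'}`. -/
def l1 {p' : ℕ} (β : Fin p' → ℝ) : ℝ := ∑ j, |β j|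

/-- `(1 / m) ∑_{i < m} (y_i - ψ(z'_i)ᵀ β)² + lam |β|₁`. -/
def lassoCriterion {p p' : ℕ} (ψ : (Fin p → ℝ) → Fin p' → ℝ) (z' : ℕ → Fin p → ℝ)
    (y : ℕ → ℝ) (m : ℕ) (lam : ℝ) (β : Fin p' → ℝ) : ℝ :=
  (m : ℝ)⁻¹ * ∑ i ∈ Finset.range m, (y i - ψ (z' i) ⬝ᵥ β) ^ 2 + lam * l1 β

/-- `(1 / m) ∑_{i < m} ψ(z'_i) ψ(z'_i)ᵀ`. -/
def gram {p p' : ℕ} (ψ : (Fin p → ℝ) → Fin p' → ℝ) (z' : ℕ → Fin p → ℝ) (m : ℕ) :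
    Matrix (Fin p') (Fin p') ℝ :=
  (m : ℝ)⁻¹ • ∑ i ∈ Finset.range m, Matrix.vecMulVec (ψ (z' i)) (ψ (z' i))

/-- The limiting criterion `(β* - β) M (β* - β)ᵀ + lam₀ |β|₁`. -/
def limitCriterion {p' : ℕ} (M : Matrix (Fin p') (Fin p') ℝ) (βstar : Fin p' → ℝ)
    (lam₀ : ℝ) (β : Fin p' → ℝ) : ℝ :=
  (βstar - β) ⬝ᵥ (M *ᵥ (βstar - β)) + lam₀ * l1 β

/-! ### The assumptions -/

/-- The partial derivative `∂ᵏ F / ∂z_{i 0} ⋯ ∂z_{i (k-1)}` at `z`. -/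
def partialDeriv {p : ℕ} (k : ℕ) (i : Fin k → Fin p) (F : (Fin p → ℝ) → ℝ)
    (z : Fin p → ℝ) : ℝ :=
  iteratedFDeriv ℝ k F z fun j => Pi.single (i j) 1

/-- `K` is a bounded, symmetric, integrable kernel of order `α`, with integral one. -/
structure IsKernelOfOrder {p : ℕ} (K : (Fin p → ℝ) → ℝ) (α : ℕ) : Prop where
  measurable : Measurable K
  bounded : ∃ C : ℝ, ∀ u, |K u| ≤ C
  symm : ∀ u, K (-u) = K u
  integrable : Integrable K
  integral_eq_one : ∫ u, K u = 1
  two_le_order : 2 ≤ α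
  integrable_moment : ∀ j, 1 ≤ j → j < α → ∀ i : Fin j → Fin p,
    Integrable fun u => K u * ∏ l, u (i l)
  moment_eq_zero : ∀ j, 1 ≤ j → j < α → ∀ i : Fin j → Fin p,
    ∫ u, K u * ∏ l, u (i l) = 0

/-- The marginal density is `α` times continuously differentiable, with `α`-th order partial
derivatives along segments issued from `𝒵` uniformly integrable against `|K|(u) |u|^α`. -/
structure MarginalSmooth {p : ℕ} (f : ℝ × ℝ → (Fin p → ℝ) → ℝ) (K : (Fin p → ℝ) → ℝ)
    (α : ℕ) (𝒵 : Set (Fin p → ℝ)) : Prop where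
  contDiff : ContDiff ℝ α (marginalZ f)
  bound : ∃ C : ℝ, 0 < C ∧ ∀ z ∈ 𝒵,
    ∫⁻ u : Fin p → ℝ, ‖K u‖ₑ * ∑ i : Fin α → Fin p, ‖∏ l, u (i l)‖ₑ *
      ⨆ t ∈ Icc (0 : ℝ) 1, ‖partialDeriv α i (marginalZ f) (z + t • u)‖ₑ
    ≤ ENNReal.ofReal C

/-- The marginal density is bounded, and bounded away from zero, on `𝒵`. -/
def MarginalBounded {p : ℕ} (f : ℝ × ℝ → (Fin p → ℝ) → ℝ) (𝒵 : Set (Fin p → ℝ)) : Prop :=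
  ∃ fmin fmax : ℝ, 0 < fmin ∧ 0 < fmax ∧
    ∀ z ∈ 𝒵, fmin ≤ marginalZ f z ∧ marginalZ f z ≤ fmax

/-- `sup_{t ∈ [0,1]} |∂ᵏ f(x₁, z + t u) / ∂z_{i} · ∂ˡ f(x₂, z + t v) / ∂z_{j}|`. -/
def supProd {p : ℕ} (f : ℝ × ℝ → (Fin p → ℝ) → ℝ) (k l : ℕ) (i : Fin k → Fin p)
    (j : Fin l → Fin p) (u v : Fin p → ℝ) (x₁ x₂ : ℝ × ℝ) (z : Fin p → ℝ) : ℝ≥0∞ :=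
  ⨆ t ∈ Icc (0 : ℝ) 1,
    ‖partialDeriv k i (f x₁) (z + t • u) * partialDeriv l j (f x₂) (z + t • v)‖ₑ

/-- Each `z ↦ f(x, z)` is of class `C^{α-1}` with locally Lipschitz derivative of order `α - 1`
(hence is almost everywhere differentiable up to the order `α`), and the products of partial
derivatives of total order `α` satisfy a uniform integrability bound. A multi-index
`(i₁, …, i_α)` is written as the pair of its first `k` and its last `α - k` entries. -/
structure JointSmooth {p : ℕ} (f : ℝ × ℝ → (Fin p → ℝ) → ℝ) (K : (Fin p → ℝ) → ℝ)
    (α : ℕ) (𝒵 : Set (Fin p → ℝ)) : Prop where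
  contDiff : ∀ x, ContDiff ℝ (α - 1 : ℕ) (f x)
  locallyLipschitz : ∀ x, LocallyLipschitz (iteratedFDeriv ℝ (α - 1) (f x))
  bound : ∃ C : ℝ, 0 < C ∧ ∀ z ∈ 𝒵,
    ∫⁻ x₁ : ℝ × ℝ, ∫⁻ x₂ : ℝ × ℝ, ∫⁻ u : Fin p → ℝ, ∫⁻ v : Fin p → ℝ,
      ‖K u‖ₑ * ‖K v‖ₑ * ∑ k ∈ Finset.range (α + 1), (α.choose k : ℝ≥0∞) *
        ∑ i : Fin k → Fin p, ∑ j : Fin (α - k) → Fin p,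
          supProd f k (α - k) i j u v x₁ x₂ z * ‖(∏ a, u (i a)) * ∏ b, v (j b)‖ₑ
    ≤ ENNReal.ofReal C

/-- The basis functions are bounded on `𝒵`; the link `Lam` is increasing and continuously
differentiable on `(-1, 1)`, with bounded derivative near the range of the conditional
Kendall's tau over `𝒵`. Its values outside `(-1, 1)` are unconstrained. -/
structure LinkAssumption {p p' : ℕ} (f : ℝ × ℝ → (Fin p → ℝ) → ℝ)
    (ψ : (Fin p → ℝ) → Fin p' → ℝ) (Lam : ℝ → ℝ) (𝒵 : Set (Fin p → ℝ)) : Prop where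
  basis_bounded : ∃ C : ℝ, ∀ z ∈ 𝒵, ∀ j, |ψ z j| ≤ C
  increasing : MonotoneOn Lam (Ioo (-1) 1)
  contDiffOn : ContDiffOn ℝ 1 Lam (Ioo (-1) 1)
  deriv_bounded : ∃ U : Set ℝ, IsOpen U ∧ condTau f '' 𝒵 ⊆ U ∧
    ∃ C : ℝ, ∀ t ∈ U ∩ Ioo (-1) 1, |deriv Lam t| ≤ C

/-- `(X_i, Z_i)`, `i ≥ 0`, are i.i.d. with joint density `f`. -/
structure IsSample {p : ℕ} {Ω : Type*} [MeasurableSpace Ω] (P : Measure Ω)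
    (f : ℝ × ℝ → (Fin p → ℝ) → ℝ) (X : ℕ → Ω → ℝ × ℝ) (Z : ℕ → Ω → Fin p → ℝ) : Prop where
  density_measurable : Measurable (Function.uncurry f)
  density_nonneg : ∀ x z, 0 ≤ f x z
  measurable_X : ∀ i, Measurable (X i)
  measurable_Z : ∀ i, Measurable (Z i)
  indep : iIndepFun (fun i ω => (X i ω, Z i ω)) P
  law : ∀ i, P.map (fun ω => (X i ω, Z i ω)) =
    (volume : Measure ((ℝ × ℝ) × (Fin p → ℝ))).withDensity
      fun q => ENNReal.ofReal (f q.1 q.2)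

end CondKendall

end

/-! The estimator at a point is a quotient of two V-statistics, with kernels `K_h K_h g` and `K_h
K_h`. Their limits are `f_Z² τ` and `f_Z²`: the law of `X` given `Z = z` has a density, so ties are
null and all three choices of `g` have mean `τ` (`integral_kernel_eq`).

Bias. Under the joint law, the mean of the kernel is a bilinear integral of `f(x, ζ) K_h(ζ - z)`;
since `∫ K = 1`, the limit is the same integral with `f(x, z)` in place of `f(x, ζ)`. The two
functions are close in `L¹`, uniformly over the compact set. By Scheffé's argument, their distance
is at most a smoothed increment of `f_Z`, which Taylor's formula makes `O(h)`, plus twice a smoothed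
deficit `∫ (f(x, z) - f(x, ζ))⁺ dx`, which dominated convergence and compactness make small
(`eventually_abs_integral_pairKernel_sub_le`).

Fluctuation. Hoeffding's device writes a U-statistic as an average, over permutations, of means of
independent blocks. Convexity of `exp` then gives a Bernstein bound (`measure_pairMean_ge_le`). The
sup norm and the second moment of the kernel are both `O(h^{-2p})`, whence a tail `exp(-a n h^{2p})`
uniform in `z`. The diagonal costs `O(1 / (n h^{2p}))`, negligible by the rate condition.

Regression. A union bound over the `n'` design points is absorbed by that same condition, so the
estimates are uniformly close to `τ` there with probability tending to one. The set `τ(𝒵)` is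
compact in the open interval `(-1, 1)`, by continuity of `τ` and a Steinhaus argument that makes
concordance and discordance both of positive probability. Hence the link is uniformly continuous
near it and the responses are uniformly close to `ψᵀβ*`. What remains is deterministic: by
convexity, a minimizer lies in a small ball as soon as the criterion on the sphere exceeds its value
at the centre (`exists_eventually_dist_lt`). -/

namespace CondKendall

/-! ### A Bernstein inequality for U-statistics of order two -/

section UStatistic

/-- The average of `F` over ordered pairs of distinct indices. -/
noncomputable def pairMean {ι : Type*} [Fintype ι] [DecidableEq ι] (F : ι → ι → ℝ) : ℝ :=
  (((Finset.univ : Finset ι).offDiag.card : ℝ))⁻¹ *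
    ∑ q ∈ (Finset.univ : Finset ι).offDiag, F q.1 q.2

/-- The symmetric group is two-transitive: one swap carries `a` to `i`, and a second corrects the
image of `b` without moving `i`. -/
lemma exists_perm_pair {ι : Type*} [DecidableEq ι] {a b i j : ι} (hab : a ≠ b) (hij : i ≠ j) :
    ∃ π : Equiv.Perm ι, π a = i ∧ π b = j := by
  refine ⟨(Equiv.swap (Equiv.swap a i b) j) * (Equiv.swap a i), ?_, by simp⟩
  have h1 : i ≠ Equiv.swap a i b := by
    intro h
    apply hab
    apply (Equiv.swap a i).injective
    rw [← h, Equiv.swap_apply_left]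
  simp [Equiv.swap_apply_of_ne_of_ne h1 hij]

lemma sum_offDiag_perm {ι : Type*} [Fintype ι] [DecidableEq ι] (F : ι → ι → ℝ)
    (σ : Equiv.Perm ι) :
    ∑ q ∈ (Finset.univ : Finset ι).offDiag, F (σ q.1) (σ q.2) =
      ∑ q ∈ (Finset.univ : Finset ι).offDiag, F q.1 q.2 := by
  refine Finset.sum_equiv (σ.prodCongr σ) (fun q => ?_) (fun q _ => rfl)
  simp

/-- The average over all permutations of the value at a fixed pair is the average over pairs. -/
lemma pairMean_eq_perm_mean {ι : Type*} [Fintype ι] [DecidableEq ι] (F : ι → ι → ℝ)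
    {a b : ι} (hab : a ≠ b) :
    pairMean F = ((Fintype.card (Equiv.Perm ι) : ℝ))⁻¹ *
      ∑ σ : Equiv.Perm ι, F (σ a) (σ b) := by
  -- Reindexing the group by `σ ↦ σ π` shows that the sum over permutations is the same at every
  -- off-diagonal pair; `hB` then counts the double sum in the other order.
  have hA : ∀ q ∈ (Finset.univ : Finset ι).offDiag,
      ∑ σ : Equiv.Perm ι, F (σ q.1) (σ q.2) = ∑ σ : Equiv.Perm ι, F (σ a) (σ b) := by
    intro q hq
    obtain ⟨π, h1, h2⟩ := exists_perm_pair hab (by simpa using hq : q.1 ≠ q.2)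
    rw [← h1, ← h2]
    exact Fintype.sum_equiv (Equiv.mulRight π) _ _ (fun σ => by simp)
  have hB : ∑ q ∈ (Finset.univ : Finset ι).offDiag, ∑ σ : Equiv.Perm ι, F (σ q.1) (σ q.2) =
      ∑ σ : Equiv.Perm ι, ∑ q ∈ (Finset.univ : Finset ι).offDiag, F q.1 q.2 := by
    rw [Finset.sum_comm]
    exact Finset.sum_congr rfl fun σ _ => sum_offDiag_perm F σ
  rw [Finset.sum_congr rfl hA] at hB
  simp only [Finset.sum_const, nsmul_eq_mul, Finset.card_univ] at hB
  have h0 : ((Finset.univ : Finset ι).offDiag.card : ℝ) ≠ 0 := by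
    have : (a, b) ∈ (Finset.univ : Finset ι).offDiag := by simpa using hab
    exact_mod_cast (Finset.card_pos.2 ⟨_, this⟩).ne'
  have h1 : (Fintype.card (Equiv.Perm ι) : ℝ) ≠ 0 := by
    exact_mod_cast Fintype.card_ne_zero
  unfold pairMean
  field_simp
  linarith

variable {Ω E : Type*} [MeasurableSpace Ω] [MeasurableSpace E]

/-- Disjoint pairs of an i.i.d. family are i.i.d. with the product law. -/
lemma map_pairs_eq_pi {ι κ : Type*} [Fintype κ] {P : Measure Ω}
    {μ : Measure E} [IsProbabilityMeasure μ] {ξ : ι → Ω → E} (hξm : ∀ i, Measurable (ξ i))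
    (hξ : iIndepFun ξ P) (hlaw : ∀ i, P.map (ξ i) = μ) {a b : κ → ι}
    (hab : Function.Injective (Sum.elim a b)) :
    P.map (fun ω (l : κ) => (ξ (a l) ω, ξ (b l) ω)) = Measure.pi fun _ => μ.prod μ := by
  -- Injectivity of `Sum.elim a b` makes all the indices used distinct, so the joint law over `κ ⊕
  -- κ` is a product. Two measure-preserving rearrangements, `(κ ⊕ κ → E) ≃ (κ → E) × (κ → E) ≃ (κ →
  -- E × E)`, do the rest.
  have h1 := (hξ.precomp hab).map_fun_eq_pi_map (fun i => (hξm _).aemeasurable)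
  simp only [hlaw] at h1
  have h2 := (measurePreserving_sumPiEquivProdPi (ι := κ) (ι' := κ) (fun _ => μ)).map_eq
  have h3 := ((measurePreserving_arrowProdEquivProdArrow E E κ (fun _ => μ)
    (fun _ => μ)).symm).map_eq
  rw [← h3, ← h2, ← h1, Measure.map_map (MeasurableEquiv.measurable _)
    (measurable_pi_lambda _ fun i => hξm _), Measure.map_map (MeasurableEquiv.measurable _)
    ((MeasurableEquiv.measurable _).comp (measurable_pi_lambda _ fun i => hξm _))]
  rfl

/-- The exponential moment of a bounded centred variable. -/
lemma integral_exp_le {μ : Measure E} [IsProbabilityMeasure μ] {φ : E → ℝ} (hφ : Measurable φ)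
    {B v s : ℝ} (hB : ∀ x, |φ x| ≤ B) (h0 : ∫ x, φ x ∂μ = 0) (hv : ∫ x, φ x ^ 2 ∂μ ≤ v)
    (hs : 0 ≤ s) (hsB : s * B ≤ 1) :
    ∫ x, Real.exp (s * φ x) ∂μ ≤ Real.exp (s ^ 2 * v) := by
  have hb : ∀ x, |s * φ x| ≤ 1 := fun x => by
    rw [abs_mul, abs_of_nonneg hs]
    exact (mul_le_mul_of_nonneg_left (hB x) hs).trans hsB
  have hi1 : Integrable φ μ :=
    Integrable.of_bound hφ.aestronglyMeasurable B (ae_of_all _ fun x => hB x)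
  have hi2 : Integrable (fun x => φ x ^ 2) μ := by
    refine Integrable.of_bound (hφ.pow_const 2).aestronglyMeasurable (B ^ 2)
      (ae_of_all _ fun x => ?_)
    rw [Real.norm_eq_abs, abs_pow]
    exact pow_le_pow_left₀ (abs_nonneg _) (hB x) 2
  have hi3 : Integrable (fun x => Real.exp (s * φ x)) μ := by
    refine Integrable.of_bound (hφ.const_mul s).exp.aestronglyMeasurable (Real.exp 1)
      (ae_of_all _ fun x => ?_)
    rw [Real.norm_eq_abs, Real.abs_exp]
    exact Real.exp_le_exp.2 ((abs_le.1 (hb x)).2)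
  calc ∫ x, Real.exp (s * φ x) ∂μ
      ≤ ∫ x, (1 + s * φ x + s ^ 2 * φ x ^ 2) ∂μ := by
        refine integral_mono hi3 (((integrable_const 1).add (hi1.const_mul s)).add
          (hi2.const_mul (s ^ 2))) fun x => ?_
        -- The inequality `exp y ≤ 1 + y + y²`, valid for `|y| ≤ 1`; this is what `s * B ≤ 1` is
        -- for.
        have := (abs_le.1 (Real.abs_exp_sub_one_sub_id_le (hb x))).2
        simp only
        nlinarith
    _ = 1 + s ^ 2 * ∫ x, φ x ^ 2 ∂μ := by
        have e1 : ∫ x, (1 + s * φ x + s ^ 2 * φ x ^ 2) ∂μ =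
            ∫ x, (1 + s * φ x) ∂μ + ∫ x, s ^ 2 * φ x ^ 2 ∂μ :=
          integral_add ((integrable_const 1).add (hi1.const_mul s)) (hi2.const_mul (s ^ 2))
        have e2 : ∫ x, (1 + s * φ x) ∂μ = ∫ _x, (1 : ℝ) ∂μ + ∫ x, s * φ x ∂μ :=
          integral_add (integrable_const 1) (hi1.const_mul s)
        rw [e1, e2, integral_const_mul, integral_const_mul, h0]
        simp
    _ ≤ 1 + s ^ 2 * v := by gcongr
    _ ≤ Real.exp (s ^ 2 * v) := by rw [add_comm]; exact Real.add_one_le_exp _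

/-- Bernstein's inequality for U-statistics (one-sided, centred kernel). -/
lemma measure_pairMean_ge_le {ι κ : Type*} [Fintype ι] [DecidableEq ι] [Fintype κ] [Nonempty κ]
    {P : Measure Ω} [IsProbabilityMeasure P] {μ : Measure E} [IsProbabilityMeasure μ]
    {ξ : ι → Ω → E} (hξm : ∀ i, Measurable (ξ i))
    (hξ : iIndepFun ξ P) (hlaw : ∀ i, P.map (ξ i) = μ) {a b : κ → ι}
    (hab : Function.Injective (Sum.elim a b))
    {φ : E × E → ℝ} (hφ : Measurable φ) {B v s t : ℝ} (hB : ∀ x, |φ x| ≤ B)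
    (h0 : ∫ x, φ x ∂(μ.prod μ) = 0) (hv : ∫ x, φ x ^ 2 ∂(μ.prod μ) ≤ v)
    (hs : 0 ≤ s) (hsB : s * B ≤ 1) :
    P.real {ω | t ≤ pairMean fun i j => φ (ξ i ω, ξ j ω)} ≤
      Real.exp (-(Fintype.card κ * (s * t - s ^ 2 * v))) := by
  set k : ℝ := ((Fintype.card κ : ℕ) : ℝ) with hk
  have hkpos : 0 < k := by rw [hk]; exact_mod_cast Fintype.card_pos
  set N : ℝ := ((Fintype.card (Equiv.Perm ι) : ℕ) : ℝ) with hN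
  have hNpos : 0 < N := by rw [hN]; exact_mod_cast Fintype.card_pos
  have hne : ∀ l, a l ≠ b l := fun l h => by
    have := @hab (Sum.inl l) (Sum.inr l) h
    cases this
  -- block representation
  have hrep : ∀ ω, k * pairMean (fun i j => φ (ξ i ω, ξ j ω)) =
      ∑ σ : Equiv.Perm ι, N⁻¹ • ∑ l, φ (ξ (σ (a l)) ω, ξ (σ (b l)) ω) := by
    intro ω
    rw [← Finset.smul_sum, Finset.sum_comm, smul_eq_mul, Finset.mul_sum]
    have : ∀ l, N⁻¹ * ∑ σ : Equiv.Perm ι, φ (ξ (σ (a l)) ω, ξ (σ (b l)) ω) =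
        pairMean (fun i j => φ (ξ i ω, ξ j ω)) := fun l =>
      (pairMean_eq_perm_mean (fun i j => φ (ξ i ω, ξ j ω)) (hne l)).symm
    simp only [this]
    simp [hk]
  have hmeasσ : ∀ σ : Equiv.Perm ι, Measurable fun ω =>
      ∑ l, φ (ξ (σ (a l)) ω, ξ (σ (b l)) ω) := fun σ =>
    Finset.measurable_sum _ fun l _ => hφ.comp ((hξm _).prodMk (hξm _))
  have hbdσ : ∀ (σ : Equiv.Perm ι) ω, s * ∑ l, φ (ξ (σ (a l)) ω, ξ (σ (b l)) ω) ≤ k := by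
    intro σ ω
    rw [Finset.mul_sum]
    calc ∑ l, s * φ (ξ (σ (a l)) ω, ξ (σ (b l)) ω) ≤ ∑ _l : κ, (1 : ℝ) :=
          Finset.sum_le_sum fun l _ =>
            (mul_le_mul_of_nonneg_left ((le_abs_self _).trans (hB _)) hs).trans hsB
      _ = k := by simp [hk]
  have hintσ : ∀ σ : Equiv.Perm ι, Integrable (fun ω =>
      Real.exp (s * ∑ l, φ (ξ (σ (a l)) ω, ξ (σ (b l)) ω))) P := fun σ => by
    refine Integrable.of_bound ((hmeasσ σ).const_mul s).exp.aestronglyMeasurable (Real.exp k)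
      (ae_of_all _ fun ω => ?_)
    rw [Real.norm_eq_abs, Real.abs_exp]
    exact Real.exp_le_exp.2 (hbdσ σ ω)
  -- For a fixed permutation the blocks are disjoint, hence i.i.d., and the exponential moment
  -- factorizes.
  have hσ : ∀ σ : Equiv.Perm ι, ∫ ω, Real.exp (s * ∑ l, φ (ξ (σ (a l)) ω, ξ (σ (b l)) ω)) ∂P
      ≤ Real.exp (s ^ 2 * v) ^ (Fintype.card κ) := by
    intro σ
    have hinj : Function.Injective (Sum.elim (fun l => σ (a l)) (fun l => σ (b l))) := by
      have : Sum.elim (fun l => σ (a l)) (fun l => σ (b l)) = σ ∘ Sum.elim a b := by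
        ext x; cases x <;> rfl
      rw [this]
      exact σ.injective.comp hab
    have hl := map_pairs_eq_pi hξm hξ hlaw hinj
    have : ∫ ω, Real.exp (s * ∑ l, φ (ξ (σ (a l)) ω, ξ (σ (b l)) ω)) ∂P =
        ∫ y : κ → E × E, ∏ l, Real.exp (s * φ (y l)) ∂(Measure.pi fun _ => μ.prod μ) := by
      rw [← hl, integral_map]
      · simp_rw [Finset.mul_sum, Real.exp_sum]
      · exact (measurable_pi_lambda _ fun l => (hξm _).prodMk (hξm _)).aemeasurable
      · refine (Finset.measurable_prod _ fun l _ => ?_).aestronglyMeasurable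
        exact ((hφ.comp (measurable_pi_apply l)).const_mul s).exp
    rw [this, integral_fintype_prod_eq_pow (fun x => Real.exp (s * φ x))]
    exact pow_le_pow_left₀ (integral_nonneg fun x => (Real.exp_pos _).le)
      (integral_exp_le hφ hB h0 hv hs hsB) _
  -- Jensen
  have hJ : ∀ ω, Real.exp ((s * k) * pairMean (fun i j => φ (ξ i ω, ξ j ω))) ≤
      ∑ σ : Equiv.Perm ι, N⁻¹ * Real.exp (s * ∑ l, φ (ξ (σ (a l)) ω, ξ (σ (b l)) ω)) := by
    intro ω
    have := convexOn_exp.map_sum_le (t := (Finset.univ : Finset (Equiv.Perm ι)))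
      (w := fun _ => N⁻¹) (p := fun σ => s * ∑ l, φ (ξ (σ (a l)) ω, ξ (σ (b l)) ω))
      (fun _ _ => (inv_pos.2 hNpos).le) (by simp [← hN, hNpos.ne']) (fun _ _ => mem_univ _)
    rw [mul_assoc, hrep ω, Finset.mul_sum]
    simp only [smul_eq_mul] at this ⊢
    simpa only [mul_left_comm] using this
  have hmeasU : Measurable fun ω => pairMean (fun i j => φ (ξ i ω, ξ j ω)) := by
    unfold pairMean
    exact (Finset.measurable_sum _ fun q _ => hφ.comp ((hξm _).prodMk (hξm _))).const_mul _
  have hintS : Integrable (fun ω => ∑ σ : Equiv.Perm ι,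
      N⁻¹ * Real.exp (s * ∑ l, φ (ξ (σ (a l)) ω, ξ (σ (b l)) ω))) P :=
    integrable_finsetSum _ fun σ _ => (hintσ σ).const_mul _
  have hint : Integrable
      (fun ω => Real.exp ((s * k) * pairMean (fun i j => φ (ξ i ω, ξ j ω)))) P := by
    refine hintS.mono' (hmeasU.const_mul _).exp.aestronglyMeasurable (ae_of_all _ fun ω => ?_)
    rw [Real.norm_eq_abs, Real.abs_exp]
    exact hJ ω
  have hmgf : mgf (fun ω => pairMean (fun i j => φ (ξ i ω, ξ j ω))) P (s * k) ≤
      Real.exp (k * (s ^ 2 * v)) := by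
    calc mgf (fun ω => pairMean (fun i j => φ (ξ i ω, ξ j ω))) P (s * k)
        ≤ ∫ ω, ∑ σ : Equiv.Perm ι,
            N⁻¹ * Real.exp (s * ∑ l, φ (ξ (σ (a l)) ω, ξ (σ (b l)) ω)) ∂P :=
          integral_mono hint hintS hJ
      _ = ∑ σ : Equiv.Perm ι, N⁻¹ *
            ∫ ω, Real.exp (s * ∑ l, φ (ξ (σ (a l)) ω, ξ (σ (b l)) ω)) ∂P := by
          rw [integral_finsetSum _ fun σ _ => (hintσ σ).const_mul _]
          simp_rw [integral_const_mul]
      _ ≤ ∑ _σ : Equiv.Perm ι, N⁻¹ * Real.exp (s ^ 2 * v) ^ (Fintype.card κ) :=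
          Finset.sum_le_sum fun σ _ => mul_le_mul_of_nonneg_left (hσ σ) (inv_pos.2 hNpos).le
      _ = Real.exp (k * (s ^ 2 * v)) := by
          rw [Finset.sum_const, Finset.card_univ, nsmul_eq_mul, ← hN,
            mul_inv_cancel_left₀ hNpos.ne', ← Real.exp_nat_mul]
  -- Chernoff's bound at parameter `s * k`: dependence between the block sums of different
  -- permutations costs nothing, by convexity, and the exponent is that of `k` independent blocks.
  refine (measure_ge_le_exp_mul_mgf t (mul_nonneg hs hkpos.le) hint).trans ?_
  refine (mul_le_mul_of_nonneg_left hmgf (Real.exp_pos _).le).trans (le_of_eq ?_)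
  rw [← Real.exp_add]
  congr 1
  ring

lemma pairMean_const {ι : Type*} [Fintype ι] [DecidableEq ι] [Nontrivial ι] (c : ℝ) :
    pairMean (fun _ _ : ι => c) = c := by
  obtain ⟨a, b, hab⟩ := exists_pair_ne ι
  rw [pairMean_eq_perm_mean _ hab]
  have : (Fintype.card (Equiv.Perm ι) : ℝ) ≠ 0 := by exact_mod_cast Fintype.card_ne_zero
  rw [Finset.sum_const, Finset.card_univ, nsmul_eq_mul, inv_mul_cancel_left₀ this]

lemma pairMean_sub {ι : Type*} [Fintype ι] [DecidableEq ι] (F G : ι → ι → ℝ) :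
    pairMean (fun i j => F i j - G i j) = pairMean F - pairMean G := by
  simp [pairMean, mul_sub]

lemma pairMean_neg {ι : Type*} [Fintype ι] [DecidableEq ι] (F : ι → ι → ℝ) :
    pairMean (fun i j => -F i j) = -pairMean F := by
  simp [pairMean]

/-- Bernstein's inequality for a U-statistic of order two with bounded kernel. -/
lemma measure_pairMean_sub_ge_le {n : ℕ} (hn : 2 ≤ n)
    {P : Measure Ω} [IsProbabilityMeasure P] {μ : Measure E} [IsProbabilityMeasure μ]
    {ξ : ℕ → Ω → E} (hξm : ∀ i, Measurable (ξ i))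
    (hξ : iIndepFun ξ P) (hlaw : ∀ i, P.map (ξ i) = μ)
    {φ : E × E → ℝ} (hφ : Measurable φ) {b v s t : ℝ} (hb : ∀ x, |φ x| ≤ b)
    (hv : ∫ x, φ x ^ 2 ∂(μ.prod μ) ≤ v) (hs : 0 ≤ s) (hsb : s * (2 * b) ≤ 1)
    (hst : 0 ≤ s * t - s ^ 2 * v) :
    P.real {ω | t ≤ |pairMean (fun i j : Fin n => φ (ξ i ω, ξ j ω)) - ∫ x, φ x ∂(μ.prod μ)|} ≤
      2 * Real.exp (-(n / 4 * (s * t - s ^ 2 * v))) := by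
  set m : ℝ := ∫ x, φ x ∂(μ.prod μ) with hm
  have : Nontrivial (Fin n) := Fin.nontrivial_iff_two_le.2 hn
  have : Nonempty (Fin (n / 2)) := ⟨⟨0, by omega⟩⟩
  -- The blocks are the `⌊n/2⌋` disjoint pairs `(2l, 2l + 1)`.
  set a : Fin (n / 2) → Fin n := fun l => ⟨2 * l, by omega⟩ with ha
  set c : Fin (n / 2) → Fin n := fun l => ⟨2 * l + 1, by omega⟩ with hc
  have hac : Function.Injective (Sum.elim a c) := by
    rintro (x | x) (y | y) h <;> simp [ha, hc, Fin.ext_iff] at h ⊢ <;> omega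
  have hint : Integrable φ (μ.prod μ) :=
    Integrable.of_bound hφ.aestronglyMeasurable b (ae_of_all _ hb)
  have hint2 : Integrable (fun x => φ x ^ 2) (μ.prod μ) := by
    refine Integrable.of_bound (hφ.pow_const 2).aestronglyMeasurable (b ^ 2)
      (ae_of_all _ fun x => ?_)
    rw [Real.norm_eq_abs, abs_pow]
    exact pow_le_pow_left₀ (abs_nonneg _) (hb x) 2
  have hmb : |m| ≤ b := by
    have := norm_integral_le_of_norm_le_const (μ := μ.prod μ) (f := φ) (C := b)
      (ae_of_all _ hb)
    simpa using this
  have hcent : ∫ x, (φ x - m) ∂(μ.prod μ) = 0 := by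
    rw [integral_sub hint (integrable_const _)]
    simp [← hm]
  have hvar : ∫ x, (φ x - m) ^ 2 ∂(μ.prod μ) ≤ v := by
    have : ∀ x, (φ x - m) ^ 2 = φ x ^ 2 - (2 * m) * φ x + m ^ 2 := fun x => by ring
    simp_rw [this]
    have e1 : ∫ x, (φ x ^ 2 - (2 * m) * φ x + m ^ 2) ∂(μ.prod μ) =
        ∫ x, (φ x ^ 2 - (2 * m) * φ x) ∂(μ.prod μ) + ∫ _x, m ^ 2 ∂(μ.prod μ) :=
      integral_add (hint2.sub (hint.const_mul _)) (integrable_const _)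
    have e2 : ∫ x, (φ x ^ 2 - (2 * m) * φ x) ∂(μ.prod μ) =
        ∫ x, φ x ^ 2 ∂(μ.prod μ) - ∫ x, (2 * m) * φ x ∂(μ.prod μ) :=
      integral_sub hint2 (hint.const_mul _)
    rw [e1, e2, integral_const_mul, ← hm]
    simp only [integral_const, probReal_univ, smul_eq_mul, one_mul]
    nlinarith [sq_nonneg m]
  -- Centring at most doubles the sup norm, hence the `2 * b` in `hsb`; it does not increase the
  -- second moment.
  have hB : ∀ x, |φ x - m| ≤ 2 * b := fun x =>
    (abs_sub _ _).trans (by linarith [hb x])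
  have hξ' : iIndepFun (fun i : Fin n => ξ i) P := hξ.precomp Fin.val_injective
  have h1 := measure_pairMean_ge_le (ξ := fun i : Fin n => ξ i) (fun i => hξm i) hξ'
    (fun i => hlaw i) hac (hφ.sub_const m) (t := t) hB hcent hvar hs hsb
  have h2 := measure_pairMean_ge_le (φ := fun x => -(φ x - m))
    (ξ := fun i : Fin n => ξ i) (fun i => hξm i) hξ'
    (fun i => hlaw i) hac (hφ.sub_const m).neg (t := t) (B := 2 * b) (v := v)
    (fun x => by rw [abs_neg]; exact hB x)
    (by rw [integral_neg, hcent, neg_zero]) (by simpa only [neg_sq] using hvar) hs hsb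
  simp only [pairMean_neg] at h2
  simp only [pairMean_sub, pairMean_const] at h1 h2
  have hexp : Real.exp (-(Fintype.card (Fin (n / 2)) * (s * t - s ^ 2 * v))) ≤
      Real.exp (-(n / 4 * (s * t - s ^ 2 * v))) := by
    -- `⌊n/2⌋ ≥ n/4` as soon as `n ≥ 2`; `hst` gives the sign needed to use it in the exponent.
    have : (n : ℝ) / 4 ≤ ((n / 2 : ℕ) : ℝ) := by
      rw [div_le_iff₀ (by norm_num)]
      exact_mod_cast (by omega : n ≤ n / 2 * 4)
    simp only [Fintype.card_fin]
    gcongr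
  have hsub : {ω | t ≤ |pairMean (fun i j : Fin n => φ (ξ i ω, ξ j ω)) - m|} ⊆
      {ω | t ≤ pairMean (fun i j : Fin n => φ (ξ i ω, ξ j ω)) - m} ∪
      {ω | t ≤ -(pairMean (fun i j : Fin n => φ (ξ i ω, ξ j ω)) - m)} := by
    intro ω hω
    simpa only [mem_union, mem_ofPred_eq] using le_abs.1 (mem_ofPred_eq.mp hω)
  refine (measureReal_mono hsub).trans ((measureReal_union_le _ _).trans ?_)
  linarith

end UStatistic

/-! ### Minimizers of the penalized criterion -/

section Lasso

variable {p p' : ℕ}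

lemma dotProduct_gram_mulVec (ψ : (Fin p → ℝ) → Fin p' → ℝ) (z' : ℕ → Fin p → ℝ) (m : ℕ)
    (v : Fin p' → ℝ) :
    v ⬝ᵥ (gram ψ z' m *ᵥ v) = (m : ℝ)⁻¹ * ∑ i ∈ Finset.range m, (ψ (z' i) ⬝ᵥ v) ^ 2 := by
  simp only [gram, Matrix.smul_mulVec, Matrix.sum_mulVec, Matrix.vecMulVec_mulVec,
    dotProduct_smul, dotProduct_sum, smul_eq_mul]
  congr 1
  refine Finset.sum_congr rfl fun i _ => ?_
  rw [dotProduct_comm v (ψ (z' i)), sq]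
  simp [dotProduct_comm]

lemma continuous_l1 : Continuous (l1 : (Fin p' → ℝ) → ℝ) := by
  unfold l1; fun_prop

lemma continuous_limitCriterion (βstar : Fin p' → ℝ) :
    Continuous fun x : (Matrix (Fin p') (Fin p') ℝ × ℝ) × (Fin p' → ℝ) =>
      limitCriterion x.1.1 βstar x.1.2 x.2 := by
  unfold limitCriterion
  refine Continuous.add ?_ (Continuous.mul (by fun_prop) (continuous_l1.comp continuous_snd))
  have h1 : Continuous fun x : (Matrix (Fin p') (Fin p') ℝ × ℝ) × (Fin p' → ℝ) =>
      βstar - x.2 := by fun_prop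
  have h2 : Continuous fun x : (Matrix (Fin p') (Fin p') ℝ × ℝ) × (Fin p' → ℝ) => x.1.1 := by
    fun_prop
  exact h1.dotProduct (h2.matrix_mulVec h1)

/-- The penalized criterion, expanded around the true parameter. -/
lemma lassoCriterion_eq (ψ : (Fin p → ℝ) → Fin p' → ℝ) (z' : ℕ → Fin p → ℝ) (y : ℕ → ℝ) (m : ℕ)
    (lam : ℝ) (βstar β : Fin p' → ℝ) :
    lassoCriterion ψ z' y m lam β =
      (m : ℝ)⁻¹ * ∑ i ∈ Finset.range m, (y i - ψ (z' i) ⬝ᵥ βstar) ^ 2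
      + (m : ℝ)⁻¹ * ∑ i ∈ Finset.range m,
          2 * (y i - ψ (z' i) ⬝ᵥ βstar) * (ψ (z' i) ⬝ᵥ (βstar - β))
      + limitCriterion (gram ψ z' m) βstar lam β := by
  rw [limitCriterion, dotProduct_gram_mulVec, lassoCriterion, ← add_assoc, ← mul_add, ← mul_add,
    ← Finset.sum_add_distrib, ← Finset.sum_add_distrib]
  congr 2
  refine Finset.sum_congr rfl fun i _ => ?_
  rw [dotProduct_sub]
  ring

lemma abs_dotProduct_le {C : ℝ} {u v : Fin p' → ℝ} (hu : ∀ j, |u j| ≤ C) :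
    |u ⬝ᵥ v| ≤ C * l1 v := by
  unfold l1 dotProduct
  rw [Finset.mul_sum]
  refine (Finset.abs_sum_le_sum_abs _ _).trans (Finset.sum_le_sum fun j _ => ?_)
  rw [abs_mul]
  exact mul_le_mul_of_nonneg_right (hu j) (abs_nonneg _)

lemma l1_nonneg (v : Fin p' → ℝ) : 0 ≤ l1 v := Finset.sum_nonneg fun _ _ => abs_nonneg _

lemma convexOn_l1 : ConvexOn ℝ univ (l1 : (Fin p' → ℝ) → ℝ) := by
  refine ⟨convex_univ, fun x _ y _ a c ha hc _ => ?_⟩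
  simp only [l1, smul_eq_mul, Finset.mul_sum, ← Finset.sum_add_distrib]
  refine Finset.sum_le_sum fun j _ => ?_
  refine (abs_add_le _ _).trans (le_of_eq ?_)
  simp [abs_mul, abs_of_nonneg ha, abs_of_nonneg hc]

lemma convexOn_lassoCriterion (ψ : (Fin p → ℝ) → Fin p' → ℝ) (z' : ℕ → Fin p → ℝ) (y : ℕ → ℝ)
    (m : ℕ) {lam : ℝ} (hlam : 0 ≤ lam) : ConvexOn ℝ univ (lassoCriterion ψ z' y m lam) := by
  refine ConvexOn.add ?_ (convexOn_l1.smul hlam)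
  refine ⟨convex_univ, fun x _ w _ a c ha hc hac => ?_⟩
  simp only [smul_eq_mul]
  rw [mul_left_comm a, mul_left_comm c, ← mul_add, Finset.mul_sum _ _ a, Finset.mul_sum _ _ c,
    ← Finset.sum_add_distrib]
  refine mul_le_mul_of_nonneg_left (Finset.sum_le_sum fun i _ => ?_) (by positivity)
  rw [dotProduct_add, dotProduct_smul, dotProduct_smul, smul_eq_mul, smul_eq_mul]
  have h1 : c = 1 - a := by linarith
  subst h1
  -- The convexity gap of the square is `a (1 - a) (x - w)²`.
  nlinarith [mul_nonneg (mul_nonneg ha hc) (sq_nonneg (ψ (z' i) ⬝ᵥ x - ψ (z' i) ⬝ᵥ w))]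

/-- A minimizer of a convex function is close to any point whose value is below the values on a
sphere around it. -/
lemma dist_lt_of_convexOn {E : Type*} [NormedAddCommGroup E] [NormedSpace ℝ E] {L : E → ℝ}
    (hL : ConvexOn ℝ univ L) {b β : E} {ε : ℝ} (hε : 0 < ε)
    (hS : ∀ s ∈ Metric.sphere b ε, L b < L s) (hβ : IsMinOn L univ β) : dist β b < ε := by
  by_contra hlt
  push Not at hlt
  have hd : 0 < dist β b := hε.trans_le hlt
  -- If `β` were outside the ball, the segment from `b` to `β` would cross the sphere at parameter
  -- `t`. Convexity and minimality of `β` would bound the value there by `L b`.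
  set t := ε / dist β b with ht
  have ht0 : 0 ≤ t := by positivity
  have ht1 : t ≤ 1 := (div_le_one hd).2 hlt
  have hs : (1 - t) • b + t • β ∈ Metric.sphere b ε := by
    have : (1 - t) • b + t • β - b = t • (β - b) := by
      rw [sub_smul, one_smul, smul_sub]; abel
    rw [mem_sphere_iff_norm, this, norm_smul, Real.norm_of_nonneg ht0, ← dist_eq_norm, ht,
      div_mul_cancel₀ _ hd.ne']
  have h1 := hL.2 (mem_univ b) (mem_univ β) (sub_nonneg.2 ht1) ht0 (by ring)
  have h2 := hβ (mem_univ b)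
  have h3 := hS _ hs
  simp only [mem_ofPred_eq, smul_eq_mul] at h1 h2
  nlinarith

/-- If the responses are uniformly close to the regression values, then every minimizer of the
penalized criterion is close to the unique minimizer of the limiting criterion. -/
lemma exists_eventually_dist_lt {ψ : (Fin p → ℝ) → Fin p' → ℝ} {z' : ℕ → Fin p → ℝ} {C : ℝ}
    (hC : ∀ i j, |ψ (z' i) j| ≤ C) {M : Matrix (Fin p') (Fin p') ℝ}
    (hM : Tendsto (gram ψ z') atTop (𝓝 M)) {βstar b : Fin p' → ℝ} {ℓ : Filter (ℕ × ℕ)}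
    (hℓ : ℓ ≤ atTop) {lam : ℕ × ℕ → ℝ} {lam₀ : ℝ} (hlam : ∀ q, 0 ≤ lam q)
    (hlamlim : Tendsto lam ℓ (𝓝 lam₀))
    (hb : ∀ β, β ≠ b → limitCriterion M βstar lam₀ b < limitCriterion M βstar lam₀ β)
    {ε : ℝ} (hε : 0 < ε) :
    ∃ η > 0, ∀ᶠ q in ℓ, ∀ y : ℕ → ℝ,
      (∀ i < q.2, |y i - ψ (z' i) ⬝ᵥ βstar| ≤ η) →
      ∀ β, IsMinOn (lassoCriterion ψ z' y q.2 (lam q)) univ β → dist β b < ε := by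
  have hcont : Continuous (limitCriterion M βstar lam₀) :=
    (continuous_limitCriterion βstar).comp (Continuous.prodMk_right (M, lam₀))
  -- The gap `κ` comes from compactness of the sphere and uniqueness of the minimizer; the sphere
  -- can be empty, for `p' = 0`.
  obtain ⟨κ, hκ, hκS⟩ : ∃ κ > 0, ∀ s ∈ Metric.sphere b ε,
      limitCriterion M βstar lam₀ b + κ ≤ limitCriterion M βstar lam₀ s := by
    rcases (Metric.sphere b ε).eq_empty_or_nonempty with h | h
    · exact ⟨1, one_pos, by simp [h]⟩
    · obtain ⟨s₀, hs₀, hmin⟩ := (isCompact_sphere b ε).exists_isMinOn h hcont.continuousOn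
      refine ⟨limitCriterion M βstar lam₀ s₀ - limitCriterion M βstar lam₀ b, ?_, fun s hs => ?_⟩
      · refine sub_pos.2 (hb s₀ fun h => ?_)
        rw [h, mem_sphere_iff_norm, sub_self, norm_zero] at hs₀
        exact hε.ne hs₀
      · have : limitCriterion M βstar lam₀ s₀ ≤ limitCriterion M βstar lam₀ s := hmin hs
        linarith
  obtain ⟨R, hR⟩ : ∃ R, ∀ β ∈ Metric.closedBall b ε, l1 (βstar - β) ≤ R := by
    have hc : Continuous fun β : Fin p' → ℝ => l1 (βstar - β) :=
      continuous_l1.comp (continuous_const.sub continuous_id)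
    obtain ⟨R, hR⟩ := ((isCompact_closedBall b ε).image hc).bddAbove
    exact ⟨R, fun β hβ => hR (mem_image_of_mem _ hβ)⟩
  have hR0 : 0 ≤ R := (l1_nonneg _).trans (hR b (Metric.mem_closedBall_self hε.le))
  set C' := max C 0 with hC'
  have hC'0 : 0 ≤ C' := le_max_right _ _
  -- Chosen so that the cross term of the expansion, at most `2 η C' R` on the ball, is below `κ /
  -- 4`.
  set η := κ / (8 * (C' * R + 1)) with hη
  have hη0 : 0 < η := by positivity
  have hηb : 2 * η * (C' * R) ≤ κ / 4 := by
    rw [hη, mul_div_assoc', div_mul_eq_mul_div, div_le_iff₀ (by positivity)]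
    nlinarith [mul_nonneg hC'0 hR0]
  refine ⟨η, hη0, ?_⟩
  -- Joint continuity in (matrix, penalty, `β`) and compactness of the ball make the convergence of
  -- criteria uniform on it.
  have hunif : ∀ᶠ x : Matrix (Fin p') (Fin p') ℝ × ℝ in 𝓝 (M, lam₀),
      ∀ β ∈ Metric.closedBall b ε,
        |limitCriterion x.1 βstar x.2 β - limitCriterion M βstar lam₀ β| < κ / 8 := by
    refine (isCompact_closedBall b ε).eventually_forall_of_forall_eventually fun β _ => ?_
    have h1 : Continuous fun x : (Matrix (Fin p') (Fin p') ℝ × ℝ) × (Fin p' → ℝ) =>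
        |limitCriterion x.1.1 βstar x.1.2 x.2 - limitCriterion M βstar lam₀ x.2| :=
      ((continuous_limitCriterion βstar).sub (hcont.comp continuous_snd)).abs
    have h2 := h1.tendsto ((M, lam₀), β)
    simp only [sub_self, abs_zero] at h2
    exact h2.eventually (gt_mem_nhds (by positivity))
  have hsnd : Tendsto (fun q : ℕ × ℕ => q.2) ℓ atTop :=
    (tendsto_snd.comp (le_of_eq prod_atTop_atTop_eq.symm)).mono_left hℓ
  have hev := ((hM.comp hsnd).prodMk_nhds hlamlim).eventually hunif
  filter_upwards [hev] with q hq y hy β hβ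
  have hcross : ∀ β ∈ Metric.closedBall b ε,
      |(q.2 : ℝ)⁻¹ * ∑ i ∈ Finset.range q.2,
        2 * (y i - ψ (z' i) ⬝ᵥ βstar) * (ψ (z' i) ⬝ᵥ (βstar - β))| ≤ κ / 4 := by
    intro β hβ
    have hterm : ∀ i ∈ Finset.range q.2,
        |2 * (y i - ψ (z' i) ⬝ᵥ βstar) * (ψ (z' i) ⬝ᵥ (βstar - β))| ≤ κ / 4 := by
      intro i hi
      rw [abs_mul, abs_mul, abs_two]
      refine le_trans (mul_le_mul (mul_le_mul_of_nonneg_left (hy i (Finset.mem_range.1 hi))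
        zero_le_two) (?_ : _ ≤ C' * R) (abs_nonneg _) (by positivity)) hηb
      exact (abs_dotProduct_le fun j => (hC i j).trans (le_max_left _ _)).trans
        (mul_le_mul_of_nonneg_left (hR β hβ) hC'0)
    rw [abs_mul, abs_of_nonneg (by positivity)]
    have h1 := (Finset.abs_sum_le_sum_abs _ _).trans (Finset.sum_le_sum hterm)
    rw [Finset.sum_const, Finset.card_range, nsmul_eq_mul] at h1
    refine (mul_le_mul_of_nonneg_left h1 (by positivity)).trans ?_
    -- For an empty design the inverse is zero by convention and the bound is trivial.
    rcases Nat.eq_zero_or_pos q.2 with h | h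
    · simp only [h, Nat.cast_zero, zero_mul, mul_zero]; positivity
    · rw [inv_mul_cancel_left₀ (by positivity)]
  refine dist_lt_of_convexOn (convexOn_lassoCriterion ψ z' y q.2 (hlam q)) hε (fun s hs => ?_) hβ
  -- The term free of `β` cancels. The cross terms cost at most `κ / 2` and the change of criterion
  -- at most `κ / 4`, against the gap `κ`.
  rw [lassoCriterion_eq ψ z' y q.2 (lam q) βstar b, lassoCriterion_eq ψ z' y q.2 (lam q) βstar s]
  have hbm : b ∈ Metric.closedBall b ε := Metric.mem_closedBall_self hε.le
  have hsm := Metric.sphere_subset_closedBall hs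
  have h1 := abs_le.1 (hcross b hbm)
  have h2 := abs_le.1 (hcross s hsm)
  have h3 := abs_lt.1 (hq b hbm)
  have h4 := abs_lt.1 (hq s hsm)
  have h5 := hκS s hs
  simp only [Function.comp_apply] at h3 h4
  linarith

/-- Symmetry and nonnegativity of the quadratic form hold for every empirical Gram matrix and are
closed conditions. -/
lemma posSemidef_of_tendsto_gram {ψ : (Fin p → ℝ) → Fin p' → ℝ} {z' : ℕ → Fin p → ℝ}
    {M : Matrix (Fin p') (Fin p') ℝ} (hM : Tendsto (gram ψ z') atTop (𝓝 M)) :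
    M.PosSemidef := by
  refine Matrix.PosSemidef.of_dotProduct_mulVec_nonneg ?_ fun v => ?_
  · have h1 : ∀ m, (gram ψ z' m).IsHermitian := fun m => by
      ext i j
      simp [gram, Matrix.sum_apply, Matrix.vecMulVec_apply, mul_comm]
    have h2 : Tendsto (fun m => (gram ψ z' m)ᴴ) atTop (𝓝 Mᴴ) :=
      (continuous_id.matrix_conjTranspose.tendsto M).comp hM
    exact tendsto_nhds_unique (h2.congr fun m => h1 m) hM
  · have h1 : Continuous fun G : Matrix (Fin p') (Fin p') ℝ => v ⬝ᵥ (G *ᵥ v) :=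
      continuous_const.dotProduct (continuous_id.matrix_mulVec continuous_const)
    have h2 := (h1.tendsto M).comp hM
    rw [star_trivial]
    refine ge_of_tendsto' h2 fun m => ?_
    simp only [Function.comp_apply]
    rw [dotProduct_gram_mulVec]
    positivity

/-- With an invertible limiting Gram matrix and no penalty, the limiting criterion has the true
parameter as its unique minimizer. -/
lemma limitCriterion_lt_of_isUnit {ψ : (Fin p → ℝ) → Fin p' → ℝ} {z' : ℕ → Fin p → ℝ}
    {M : Matrix (Fin p') (Fin p') ℝ} (hM : Tendsto (gram ψ z') atTop (𝓝 M)) (hunit : IsUnit M)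
    {βstar β : Fin p' → ℝ} (hβ : β ≠ βstar) :
    limitCriterion M βstar 0 βstar < limitCriterion M βstar 0 β := by
  have hpd := (posSemidef_of_tendsto_gram hM).posDef_iff_isUnit.2 hunit
  have := hpd.dotProduct_mulVec_pos (sub_ne_zero.2 hβ.symm)
  rw [star_trivial] at this
  simpa [limitCriterion] using this

end Lasso

/-! ### Kendall's tau of an absolutely continuous law on the plane -/

section Tau

open scoped Pointwise

/-- The concordant pairs. -/
def concordant : Set ((ℝ × ℝ) × (ℝ × ℝ)) := {q | 0 < (q.1.1 - q.2.1) * (q.1.2 - q.2.2)}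

/-- The discordant pairs. -/
def discordant : Set ((ℝ × ℝ) × (ℝ × ℝ)) := {q | (q.1.1 - q.2.1) * (q.1.2 - q.2.2) < 0}

lemma measurableSet_concordant : MeasurableSet concordant :=
  measurableSet_lt measurable_const (by fun_prop)

lemma measurableSet_discordant : MeasurableSet discordant :=
  measurableSet_lt (by fun_prop) measurable_const

/-- The pairs whose first point is below the second in both coordinates. -/
def lowerPairs : Set ((ℝ × ℝ) × (ℝ × ℝ)) := {q | q.1.1 < q.2.1 ∧ q.1.2 < q.2.2}

/-- The pairs whose first point is to the left of and above the second. -/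
def crossPairs : Set ((ℝ × ℝ) × (ℝ × ℝ)) := {q | q.1.1 < q.2.1 ∧ q.2.2 < q.1.2}

lemma measurableSet_lowerPairs : MeasurableSet lowerPairs := by
  have h1 : MeasurableSet {q : (ℝ × ℝ) × (ℝ × ℝ) | q.1.1 < q.2.1} :=
    measurableSet_lt (by fun_prop) (by fun_prop)
  have h2 : MeasurableSet {q : (ℝ × ℝ) × (ℝ × ℝ) | q.1.2 < q.2.2} :=
    measurableSet_lt (by fun_prop) (by fun_prop)
  exact h1.inter h2

lemma measurableSet_crossPairs : MeasurableSet crossPairs := by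
  have h1 : MeasurableSet {q : (ℝ × ℝ) × (ℝ × ℝ) | q.1.1 < q.2.1} :=
    measurableSet_lt (by fun_prop) (by fun_prop)
  have h2 : MeasurableSet {q : (ℝ × ℝ) × (ℝ × ℝ) | q.2.2 < q.1.2} :=
    measurableSet_lt (by fun_prop) (by fun_prop)
  exact h1.inter h2

lemma concordant_eq : concordant = lowerPairs ∪ Prod.swap ⁻¹' lowerPairs := by
  ext q
  simp only [concordant, lowerPairs, mem_union, mem_preimage, mem_ofPred_eq, Prod.fst_swap,
    Prod.snd_swap, mul_pos_iff, sub_pos, sub_neg]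
  tauto

lemma discordant_eq : discordant = crossPairs ∪ Prod.swap ⁻¹' crossPairs := by
  ext q
  simp only [discordant, crossPairs, mem_union, mem_preimage, mem_ofPred_eq, Prod.fst_swap,
    Prod.snd_swap, mul_neg_iff, sub_pos, sub_neg]
  tauto

/-- Comparing first coordinates makes the two pieces disjoint, and swapping two independent draws
preserves their law. This accounts for the factor `4` in `g₁` and `g₃`: each one-sided event has
half the probability of concordance or discordance. -/
lemma measureReal_union_swap {ν : Measure (ℝ × ℝ)} [IsProbabilityMeasure ν]
    {A : Set ((ℝ × ℝ) × (ℝ × ℝ))} (hA : MeasurableSet A)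
    (hlt : ∀ q ∈ A, q.1.1 < q.2.1) :
    (ν.prod ν).real (A ∪ Prod.swap ⁻¹' A) = 2 * (ν.prod ν).real A := by
  have hd : Disjoint A (Prod.swap ⁻¹' A) := by
    rw [Set.disjoint_left]
    intro q h1 h2
    exact lt_asymm (hlt q h1) (hlt q.swap h2)
  rw [measureReal_union hd (measurable_swap hA), two_mul,
    (Measure.measurePreserving_swap (μ := ν) (ν := ν)).measureReal_preimage hA.nullMeasurableSet]

lemma volume_fst_eq (c : ℝ) : (volume : Measure (ℝ × ℝ)) {y | y.1 = c} = 0 := by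
  have : {y : ℝ × ℝ | y.1 = c} = {c} ×ˢ univ := by ext; simp
  rw [this, Measure.volume_eq_prod, Measure.prod_prod]
  simp

lemma volume_snd_eq (c : ℝ) : (volume : Measure (ℝ × ℝ)) {y | y.2 = c} = 0 := by
  have : {y : ℝ × ℝ | y.2 = c} = univ ×ˢ {c} := by ext; simp
  rw [this, Measure.volume_eq_prod, Measure.prod_prod]
  simp

/-- Ties are null: for a fixed first point, they confine the second to two lines parallel to the
axes. -/
lemma measureReal_concordant_add_discordant {ν : Measure (ℝ × ℝ)} [IsProbabilityMeasure ν]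
    (hν : ν ≪ volume) :
    (ν.prod ν).real concordant + (ν.prod ν).real discordant = 1 := by
  have hd : Disjoint concordant discordant := by
    rw [Set.disjoint_left]
    intro q h1 h2
    exact lt_asymm (mem_ofPred_eq.mp h1) (mem_ofPred_eq.mp h2)
  rw [← measureReal_union hd measurableSet_discordant]
  have hm := measurableSet_concordant.union measurableSet_discordant
  have h0 : (ν.prod ν) (concordant ∪ discordant)ᶜ = 0 := by
    rw [Measure.measure_prod_null hm.compl]
    refine ae_of_all _ fun x => ?_
    apply hν
    refine measure_mono_null (t := {y | y.1 = x.1} ∪ {y | y.2 = x.2}) (fun y hy => ?_)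
      (measure_union_null (volume_fst_eq _) (volume_snd_eq _))
    simp only [concordant, discordant, mem_preimage, mem_compl_iff, mem_union, mem_ofPred_eq,
      not_or, not_lt] at hy
    have : (x.1 - y.1) * (x.2 - y.2) = 0 := le_antisymm hy.1 hy.2
    rcases mul_eq_zero.1 this with h | h
    · left; exact (sub_eq_zero.1 h).symm
    · right; exact (sub_eq_zero.1 h).symm
  rw [prob_compl_eq_zero_iff hm] at h0
  rw [Measure.real, h0, ENNReal.toReal_one]

open Classical in
lemma integral_ite_one {E : Type*} [MeasurableSpace E] (μ : Measure E)
    {A : Set E} (hA : MeasurableSet A) :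
    ∫ x, (if x ∈ A then (1 : ℝ) else 0) ∂μ = μ.real A := by
  rw [← integral_indicator_one hA]
  rfl

open Classical in
lemma integrable_ite_one {E : Type*} [MeasurableSpace E] (μ : Measure E) [IsFiniteMeasure μ]
    {A : Set E} (hA : MeasurableSet A) :
    Integrable (fun x => if x ∈ A then (1 : ℝ) else 0) μ :=
  (integrable_const (1 : ℝ)).indicator hA

/-- All three kernels have mean Kendall's tau under an absolutely continuous law. -/
lemma integral_kernel_eq {ν : Measure (ℝ × ℝ)} [IsProbabilityMeasure ν] (hν : ν ≪ volume)
    {g : ℝ × ℝ → ℝ × ℝ → ℝ} (hg : g = g₁ ∨ g = g₂ ∨ g = g₃) :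
    ∫ q, g q.1 q.2 ∂(ν.prod ν) =
      (ν.prod ν).real concordant - (ν.prod ν).real discordant := by
  classical
  have hsum := measureReal_concordant_add_discordant hν
  rcases hg with rfl | rfl | rfl
  · have h1 := measureReal_union_swap (ν := ν) measurableSet_lowerPairs fun q hq => hq.1
    rw [← concordant_eq] at h1
    have h2 : ∀ q : (ℝ × ℝ) × (ℝ × ℝ), g₁ q.1 q.2 =
        4 * (if q ∈ lowerPairs then (1 : ℝ) else 0) - 1 := fun q => by
      simp only [g₁, lowerPairs, mem_ofPred_eq]; split_ifs with h <;> simp [h]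
    simp_rw [h2]
    rw [integral_sub ((integrable_ite_one _ measurableSet_lowerPairs).const_mul 4)
      (integrable_const _), integral_const_mul, integral_ite_one _ measurableSet_lowerPairs]
    simp only [integral_const, probReal_univ, smul_eq_mul, mul_one]
    linarith
  · have h2 : ∀ q : (ℝ × ℝ) × (ℝ × ℝ), g₂ q.1 q.2 =
        (if q ∈ concordant then (1 : ℝ) else 0) - (if q ∈ discordant then (1 : ℝ) else 0) :=
      fun q => by simp only [g₂, concordant, discordant, mem_ofPred_eq]; congr!
    simp_rw [h2]
    rw [integral_sub (integrable_ite_one _ measurableSet_concordant)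
      (integrable_ite_one _ measurableSet_discordant),
      integral_ite_one _ measurableSet_concordant, integral_ite_one _ measurableSet_discordant]
  · have h1 := measureReal_union_swap (ν := ν) measurableSet_crossPairs fun q hq => hq.1
    rw [← discordant_eq] at h1
    have h2 : ∀ q : (ℝ × ℝ) × (ℝ × ℝ), g₃ q.1 q.2 =
        1 - 4 * (if q ∈ crossPairs then (1 : ℝ) else 0) := fun q => by
      simp only [g₃, crossPairs, mem_ofPred_eq]; split_ifs with h <;> simp [h]
    simp_rw [h2]
    rw [integral_sub (integrable_const _)
      ((integrable_ite_one _ measurableSet_crossPairs).const_mul 4),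
      integral_const_mul, integral_ite_one _ measurableSet_crossPairs]
    simp only [integral_const, probReal_univ, smul_eq_mul, mul_one]
    linarith

/-- A measurable set of positive measure has, with positive product measure, pairs of points whose
difference lies in an open set adherent to the origin. -/
lemma prod_measure_sub_mem_pos {S : Set (ℝ × ℝ)} (hS : MeasurableSet S)
    (hpos : 0 < (volume : Measure (ℝ × ℝ)) S) {Q : Set (ℝ × ℝ)} (hQ : IsOpen Q)
    (h0 : (0 : ℝ × ℝ) ∈ closure Q) :
    ((volume : Measure (ℝ × ℝ)).prod volume) {q | q.1 ∈ S ∧ q.2 ∈ S ∧ q.1 - q.2 ∈ Q} ≠ 0 := by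
  intro hnull
  obtain ⟨k, hkS, hk, hkpos⟩ := hS.exists_lt_isCompact hpos
  -- Steinhaus' argument: a small translate of a compact set of positive measure still meets it in
  -- positive measure.
  have hlim := tendsto_measure_vadd_sdiff_isCompact_isClosed (μ := (volume : Measure (ℝ × ℝ)))
    hk hk.isClosed
  have hev : ∀ᶠ w : ℝ × ℝ in 𝓝 0, 0 < (volume : Measure (ℝ × ℝ)) ((w +ᵥ k) ∩ k) := by
    filter_upwards [hlim.eventually (gt_mem_nhds hkpos)] with w hw
    rw [pos_iff_ne_zero]
    intro h
    have := measure_le_inter_add_sdiff (volume : Measure (ℝ × ℝ)) (w +ᵥ k) k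
    rw [h, zero_add, measure_vadd] at this
    exact absurd hw (not_lt.2 this)
  -- The pairs in the coordinates (second point, difference); the change of variables preserves
  -- Lebesgue measure, so `N` inherits nullity.
  set N : Set ((ℝ × ℝ) × (ℝ × ℝ)) := {q | q.1 ∈ k ∧ q.1 + q.2 ∈ k ∧ q.2 ∈ Q} with hN
  have hkm := hk.measurableSet
  have hNm : MeasurableSet N :=
    (measurable_fst hkm).inter (((measurable_fst.add measurable_snd) hkm).inter
      (measurable_snd hQ.measurableSet))
  have hN0 : ((volume : Measure (ℝ × ℝ)).prod volume) N = 0 := by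
    have hmp := (Measure.measurePreserving_swap (μ := (volume : Measure (ℝ × ℝ)))
      (ν := (volume : Measure (ℝ × ℝ)))).comp
      (measurePreserving_prod_add (volume : Measure (ℝ × ℝ)) (volume : Measure (ℝ × ℝ)))
    refine measure_mono_null (fun q hq => ?_) (hmp.quasiMeasurePreserving.preimage_null hnull)
    simp only [hN, mem_ofPred_eq] at hq
    simp only [mem_preimage, Function.comp_apply, Prod.swap_prod_mk, mem_ofPred_eq,
      add_sub_cancel_left]
    exact ⟨hkS hq.2.1, hkS hq.1, hq.2.2⟩
  rw [Measure.prod_apply_symm hNm, lintegral_eq_zero_iff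
    (measurable_measure_prodMk_right hNm)] at hN0
  have hev' : ∀ᶠ w : ℝ × ℝ in 𝓝 0, 0 < (volume : Measure (ℝ × ℝ)) ((-w +ᵥ k) ∩ k) := by
    have : Tendsto (fun w : ℝ × ℝ => -w) (𝓝 0) (𝓝 0) := by
      simpa using (continuous_neg (G := ℝ × ℝ)).tendsto 0
    exact this.eventually hev
  obtain ⟨U, hU, hUo, hU0⟩ := eventually_nhds_iff.1 hev'
  have hne : (U ∩ Q).Nonempty := mem_closure_iff.1 h0 U hUo hU0
  have hUQ := (hUo.inter hQ).measure_pos (volume : Measure (ℝ × ℝ)) hne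
  -- Almost every slice of `N` at a fixed difference is null, while over the nonempty open set `U ∩
  -- Q` the slices are intersections of `k` with a small translate.
  obtain ⟨w, ⟨hwU, hwQ⟩, hw⟩ := (frequently_ae_mem_iff.2 hUQ.ne').and_eventually hN0
    |>.exists
  refine (hU w hwU).ne' ?_
  have : (fun x => (x, w)) ⁻¹' N = (-w +ᵥ k) ∩ k := by
    ext v
    simp only [hN, mem_preimage, mem_ofPred_eq, mem_inter_iff, mem_vadd_set_iff_neg_vadd_mem,
      neg_neg, vadd_eq_add, add_comm w v]
    tauto
  rw [← this]
  exact hw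

/-- The product law has density `r x * r y`, so it can only neglect the event if Lebesgue measure
does on `{r ≠ 0} × {r ≠ 0}`; and `{r ≠ 0}` is not null, the total mass being one. -/
lemma withDensity_prod_ne_zero {r : ℝ × ℝ → ℝ≥0∞} (hr : Measurable r)
    [IsProbabilityMeasure ((volume : Measure (ℝ × ℝ)).withDensity r)] {Q : Set (ℝ × ℝ)}
    (hQ : IsOpen Q) (h0 : (0 : ℝ × ℝ) ∈ closure Q) :
    ((volume.withDensity r).prod (volume.withDensity r)) {q | q.1 - q.2 ∈ Q} ≠ 0 := by
  have hS : MeasurableSet {x | r x ≠ 0} := hr (measurableSet_singleton 0).compl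
  have hpos : 0 < (volume : Measure (ℝ × ℝ)) {x | r x ≠ 0} := by
    rw [pos_iff_ne_zero]
    intro h
    have h1 : (volume.withDensity r) univ = 0 := by
      rw [withDensity_apply_eq_zero' hr.aemeasurable, inter_univ, h]
    rw [measure_univ] at h1
    exact one_ne_zero h1
  intro h
  rw [prod_withDensity hr hr, withDensity_apply_eq_zero' (by fun_prop)] at h
  refine prod_measure_sub_mem_pos hS hpos hQ h0 (measure_mono_null (fun q hq => ?_) h)
  simp only [mem_ofPred_eq] at hq
  exact ⟨mul_ne_zero hq.1 hq.2.1, hq.2.2⟩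

lemma zero_mem_closure_mul_pos : (0 : ℝ × ℝ) ∈ closure {w : ℝ × ℝ | 0 < w.1 * w.2} := by
  have h : Tendsto (fun n : ℕ => ((1 / ((n : ℝ) + 1), 1 / ((n : ℝ) + 1)) : ℝ × ℝ)) atTop
      (𝓝 (0, 0)) := tendsto_one_div_add_atTop_nhds_zero_nat.prodMk_nhds
        tendsto_one_div_add_atTop_nhds_zero_nat
  exact mem_closure_of_tendsto h (Eventually.of_forall fun n => by
    simp only [mem_ofPred_eq]; positivity)

lemma zero_mem_closure_mul_neg : (0 : ℝ × ℝ) ∈ closure {w : ℝ × ℝ | w.1 * w.2 < 0} := by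
  have h : Tendsto (fun n : ℕ => ((1 / ((n : ℝ) + 1), -(1 / ((n : ℝ) + 1))) : ℝ × ℝ)) atTop
      (𝓝 (0, -0)) := tendsto_one_div_add_atTop_nhds_zero_nat.prodMk_nhds
        tendsto_one_div_add_atTop_nhds_zero_nat.neg
  rw [neg_zero] at h
  exact mem_closure_of_tendsto h (Eventually.of_forall fun n => by
    simp only [mem_ofPred_eq, mul_neg, neg_lt_zero]; positivity)

/-- Kendall's tau of an absolutely continuous law lies strictly between `-1` and `1`. -/
lemma tau_mem_Ioo {r : ℝ × ℝ → ℝ≥0∞} (hr : Measurable r)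
    [IsProbabilityMeasure ((volume : Measure (ℝ × ℝ)).withDensity r)] :
    ((volume.withDensity r).prod (volume.withDensity r)).real concordant -
      ((volume.withDensity r).prod (volume.withDensity r)).real discordant ∈ Ioo (-1 : ℝ) 1 := by
  have hsum := measureReal_concordant_add_discordant
    (withDensity_absolutelyContinuous (volume : Measure (ℝ × ℝ)) r)
  have h1 : ((volume.withDensity r).prod (volume.withDensity r)) concordant ≠ 0 :=
    withDensity_prod_ne_zero hr (Q := {w | 0 < w.1 * w.2})
      (isOpen_lt continuous_const (by fun_prop)) zero_mem_closure_mul_pos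
  have h2 : ((volume.withDensity r).prod (volume.withDensity r)) discordant ≠ 0 :=
    withDensity_prod_ne_zero hr (Q := {w | w.1 * w.2 < 0})
      (isOpen_lt (by fun_prop) continuous_const) zero_mem_closure_mul_neg
  have h3 := ENNReal.toReal_pos h1 (measure_ne_top _ _)
  have h4 := ENNReal.toReal_pos h2 (measure_ne_top _ _)
  simp only [Measure.real] at hsum ⊢
  constructor <;> linarith

end Tau

/-! ### Taylor bound for the smoothed marginal density -/

section Taylor

variable {p : ℕ}

/-- Expansion of the diagonal of an iterated derivative in partial derivatives. -/
lemma iteratedFDeriv_apply_eq_sum_partialDeriv (k : ℕ) (F : (Fin p → ℝ) → ℝ) (z u : Fin p → ℝ) :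
    iteratedFDeriv ℝ k F z (fun _ => u) =
      ∑ i : Fin k → Fin p, (∏ l, u (i l)) * partialDeriv k i F z := by
  have hu : u = ∑ j, u j • (Pi.single j (1 : ℝ) : Fin p → ℝ) := by
    conv_lhs => rw [pi_eq_sum_univ' u]
  conv_lhs => rw [hu]
  rw [ContinuousMultilinearMap.map_sum]
  refine Finset.sum_congr rfl fun i _ => ?_
  rw [ContinuousMultilinearMap.map_smul_univ, smul_eq_mul, partialDeriv]

/-- Homogeneity extracts `h ^ α ≤ h`, and `s * h` stays in `[0, 1]`, so the supremum over the
unshrunk segment still dominates. Consistency needs only a vanishing bias, so the first power of `h`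
suffices. -/
lemma enorm_taylor_remainder_le {α : ℕ} (hα : 1 ≤ α) (F : (Fin p → ℝ) → ℝ) (z u : Fin p → ℝ)
    {s : ℝ} (hs : s ∈ Icc (0 : ℝ) 1) {h : ℝ} (h0 : 0 ≤ h) (h1 : h ≤ 1) :
    ‖iteratedFDeriv ℝ α F (z + s • (h • u)) (fun _ => h • u)‖ₑ ≤ ENNReal.ofReal h *
      ∑ i : Fin α → Fin p, ‖∏ l, u (i l)‖ₑ *
        ⨆ t ∈ Icc (0 : ℝ) 1, ‖partialDeriv α i F (z + t • u)‖ₑ := by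
  have e1 : iteratedFDeriv ℝ α F (z + s • (h • u)) (fun _ => h • u) =
      h ^ α * iteratedFDeriv ℝ α F (z + s • (h • u)) (fun _ => u) := by
    have := (iteratedFDeriv ℝ α F (z + s • (h • u))).map_smul_univ (fun _ => h) (fun _ => u)
    simpa using this
  rw [e1, iteratedFDeriv_apply_eq_sum_partialDeriv, enorm_mul]
  refine mul_le_mul' ?_ ((enorm_sum_le _ _).trans (Finset.sum_le_sum fun i _ => ?_))
  · rw [Real.enorm_eq_ofReal (by positivity)]
    exact ENNReal.ofReal_le_ofReal (by simpa using pow_le_pow_of_le_one h0 h1 hα)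
  · rw [enorm_mul, smul_smul]
    gcongr
    exact le_biSup (fun t : ℝ => ‖partialDeriv α i F (z + t • u)‖ₑ)
      (⟨mul_nonneg hs.1 h0, mul_le_one₀ hs.2 h0 h1⟩ : s * h ∈ Icc (0 : ℝ) 1)

/-- Increments of a smooth function, bounded by a polynomial and the `α`-th order derivatives. -/
lemma enorm_sub_le_of_contDiff {α : ℕ} (hα : 1 ≤ α) {F : (Fin p → ℝ) → ℝ}
    (hF : ContDiff ℝ α F) {z : Fin p → ℝ} {A : ℝ}
    (hA : ∀ k < α, ‖iteratedFDeriv ℝ k F z‖ ≤ A) (u : Fin p → ℝ) {h : ℝ} (h0 : 0 ≤ h)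
    (h1 : h ≤ 1) :
    ‖F (z + h • u) - F z‖ₑ ≤ ENNReal.ofReal h *
      (ENNReal.ofReal (A * ∑ k ∈ Finset.range α, ‖u‖ ^ k) +
      ∑ i : Fin α → Fin p, ‖∏ l, u (i l)‖ₑ *
        ⨆ t ∈ Icc (0 : ℝ) 1, ‖partialDeriv α i F (z + t • u)‖ₑ) := by
  obtain ⟨n, rfl⟩ : ∃ n, α = n + 1 := ⟨α - 1, by omega⟩
  have hA0 : 0 ≤ A := (norm_nonneg _).trans (hA 0 (by omega))
  -- Taylor's formula with integral remainder of order `α = n + 1`: the intermediate terms give the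
  -- polynomial in `‖u‖`, the remainder gives the supremum.
  have hT := map_add_eq_sum_add_integral_iteratedFDeriv (f := F) (x := z) (y := h • u) (n := n)
    (fun t _ => by exact_mod_cast hF.contDiffAt)
  rw [Finset.sum_range_succ'] at hT
  simp only [Nat.factorial_zero, Nat.cast_one, inv_one, one_smul,
    iteratedFDeriv_zero_apply] at hT
  have hd : F (z + h • u) - F z =
      (∑ k ∈ Finset.range n, ((k + 1).factorial : ℝ)⁻¹ •
        iteratedFDeriv ℝ (k + 1) F z fun _ => h • u) +
      (n.factorial : ℝ)⁻¹ • ∫ t in (0 : ℝ)..1, (1 - t) ^ n •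
        iteratedFDeriv ℝ (n + 1) F (z + t • (h • u)) fun _ => h • u := by
    rw [hT]; ring
  have hfac : ∀ k : ℕ, ((k.factorial : ℝ))⁻¹ ≤ 1 := fun k =>
    inv_le_one_of_one_le₀ (by exact_mod_cast Nat.one_le_iff_ne_zero.2 k.factorial_ne_zero)
  rw [hd, mul_add]
  refine (enorm_add_le _ _).trans (add_le_add ?_ ?_)
  · rw [← ENNReal.ofReal_mul h0, ← ofReal_norm]
    refine ENNReal.ofReal_le_ofReal ((norm_sum_le _ _).trans ?_)
    rw [Finset.sum_range_succ', mul_add, mul_add, Finset.mul_sum, Finset.mul_sum]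
    refine le_add_of_le_of_nonneg (Finset.sum_le_sum fun k hk => ?_) (by positivity)
    have hk' := Finset.mem_range.1 hk
    rw [norm_smul, Real.norm_of_nonneg (by positivity)]
    calc ((k + 1).factorial : ℝ)⁻¹ * ‖iteratedFDeriv ℝ (k + 1) F z fun _ => h • u‖
        ≤ 1 * (‖iteratedFDeriv ℝ (k + 1) F z‖ * ∏ _i : Fin (k + 1), ‖h • u‖) := by
          gcongr
          · exact hfac _
          · exact ContinuousMultilinearMap.le_opNorm _ _
      _ = ‖iteratedFDeriv ℝ (k + 1) F z‖ * (h ^ (k + 1) * ‖u‖ ^ (k + 1)) := by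
          simp [norm_smul, abs_of_nonneg h0, mul_pow]
      _ ≤ A * (h * ‖u‖ ^ (k + 1)) := by
          gcongr
          · exact hA (k + 1) (by omega)
          · simpa using pow_le_pow_of_le_one h0 h1 (Nat.le_add_left 1 k)
      _ = h * (A * ‖u‖ ^ (k + 1)) := by ring
  · set W := ENNReal.ofReal h * ∑ i : Fin (n + 1) → Fin p, ‖∏ l, u (i l)‖ₑ *
        ⨆ t ∈ Icc (0 : ℝ) 1, ‖partialDeriv (n + 1) i F (z + t • u)‖ₑ with hW
    rw [enorm_smul, intervalIntegral.integral_of_le zero_le_one]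
    have hI : ‖∫ t in Ioc (0 : ℝ) 1, (1 - t) ^ n •
        iteratedFDeriv ℝ (n + 1) F (z + t • (h • u)) fun _ => h • u‖ₑ ≤ W := by
      refine (enorm_integral_le_lintegral_enorm _).trans ?_
      calc ∫⁻ t in Ioc (0 : ℝ) 1, ‖(1 - t) ^ n •
            iteratedFDeriv ℝ (n + 1) F (z + t • (h • u)) fun _ => h • u‖ₑ
          ≤ ∫⁻ _t in Ioc (0 : ℝ) 1, W := by
            refine setLIntegral_mono measurable_const fun t ht => ?_
            rw [enorm_smul]
            have ht' : t ∈ Icc (0 : ℝ) 1 := Ioc_subset_Icc_self ht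
            have h2 : ‖(1 - t) ^ n‖ₑ ≤ 1 := by
              rw [Real.enorm_eq_ofReal (pow_nonneg (by linarith [ht'.2]) _),
                ENNReal.ofReal_le_one]
              exact pow_le_one₀ (by linarith [ht'.2]) (by linarith [ht'.1])
            calc _ ≤ 1 * W := mul_le_mul' h2
                    (enorm_taylor_remainder_le (by omega) F z u ht' h0 h1)
              _ = W := one_mul _
        _ = W := by simp
    have h3 : ‖((n.factorial : ℝ))⁻¹‖ₑ ≤ 1 := by
      rw [Real.enorm_eq_ofReal (by positivity), ENNReal.ofReal_le_one]
      exact hfac n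
    calc _ ≤ 1 * W := mul_le_mul' h3 hI
      _ = W := one_mul _

/-- The sup norm is attained at some coordinate `j`, so `‖u‖ ^ k` is the absolute value of the
monomial with constant multi-index `j`. -/
lemma IsKernelOfOrder.integrable_norm_pow {K : (Fin p → ℝ) → ℝ} {α : ℕ}
    (hK : IsKernelOfOrder K α) {k : ℕ} (hk : k < α) : Integrable fun u => |K u| * ‖u‖ ^ k := by
  rcases Nat.eq_zero_or_pos k with rfl | hk0
  · simpa using hK.integrable.abs
  have h1 : Integrable fun u : Fin p → ℝ => ∑ j : Fin p, |K u * ∏ _l : Fin k, u j| :=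
    integrable_finsetSum _ fun j _ => (hK.integrable_moment k hk0 hk fun _ => j).abs
  refine h1.mono' ((hK.measurable.abs).mul (measurable_norm.pow_const k)).aestronglyMeasurable
    (ae_of_all _ fun u => ?_)
  rw [Real.norm_of_nonneg (by positivity)]
  rcases isEmpty_or_nonempty (Fin p) with he | he
  · have : ‖u‖ = 0 := by rw [Subsingleton.elim u 0, norm_zero]
    rw [this, zero_pow hk0.ne', mul_zero]
    positivity
  · obtain ⟨j, hj⟩ : ∃ j, ‖u‖ = ‖u j‖ := by
      obtain ⟨j, hj⟩ := Finite.exists_max fun j => ‖u j‖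
      exact ⟨j, le_antisymm ((pi_norm_le_iff_of_nonneg (norm_nonneg _)).2 hj) (norm_le_pi_norm u j)⟩
    calc |K u| * ‖u‖ ^ k = |K u * ∏ _l : Fin k, u j| := by
          rw [hj]; simp [abs_mul, abs_pow]
      _ ≤ ∑ j : Fin p, |K u * ∏ _l : Fin k, u j| :=
          Finset.single_le_sum (f := fun j : Fin p => |K u * ∏ _l : Fin k, u j|)
            (fun _ _ => abs_nonneg _) (Finset.mem_univ j)

/-- The smoothed increments of the marginal density are `O(h)`, uniformly on a compact set. -/
lemma MarginalSmooth.exists_smoothed_increment_le {f : ℝ × ℝ → (Fin p → ℝ) → ℝ}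
    {K : (Fin p → ℝ) → ℝ} {α : ℕ} {𝒵 : Set (Fin p → ℝ)} (h𝒵 : IsCompact 𝒵)
    (hK : IsKernelOfOrder K α) (hf : MarginalSmooth f K α 𝒵) :
    ∃ C : ℝ, 0 ≤ C ∧ ∀ z ∈ 𝒵, ∀ h : ℝ, 0 ≤ h → h ≤ 1 →
      Integrable (fun u => |K u| * |marginalZ f (z + h • u) - marginalZ f z|) ∧
      ∫ u, |K u| * |marginalZ f (z + h • u) - marginalZ f z| ≤ C * h := by
  have hα : 1 ≤ α := le_trans (by norm_num) hK.two_le_order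
  obtain ⟨A, hA⟩ : ∃ A, ∀ z ∈ 𝒵, ∀ k < α, ‖iteratedFDeriv ℝ k (marginalZ f) z‖ ≤ A := by
    have hc : Continuous fun z =>
        ∑ k ∈ Finset.range α, ‖iteratedFDeriv ℝ k (marginalZ f) z‖ :=
      continuous_finsetSum _ fun k hk => (hf.contDiff.continuous_iteratedFDeriv
        (by exact_mod_cast (Finset.mem_range.1 hk).le)).norm
    obtain ⟨A, hA⟩ := (h𝒵.image hc).bddAbove
    refine ⟨A, fun z hz k hk => le_trans ?_ (hA (mem_image_of_mem _ hz))⟩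
    exact Finset.single_le_sum (f := fun k => ‖iteratedFDeriv ℝ k (marginalZ f) z‖)
      (fun _ _ => norm_nonneg _) (Finset.mem_range.2 hk)
  obtain ⟨C, hC0, hC⟩ := hf.bound
  set A' := max A 0
  have hpoly : Integrable fun u : Fin p → ℝ =>
      |K u| * (A' * ∑ k ∈ Finset.range α, ‖u‖ ^ k) := by
    have : Integrable fun u : Fin p → ℝ => A' * ∑ k ∈ Finset.range α, |K u| * ‖u‖ ^ k :=
      (integrable_finsetSum _ fun k hk =>
        hK.integrable_norm_pow (Finset.mem_range.1 hk)).const_mul A'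
    refine this.congr (ae_of_all _ fun u => ?_)
    simp only [Finset.mul_sum]
    exact Finset.sum_congr rfl fun k _ => by ring
  set I := ∫ u : Fin p → ℝ, |K u| * (A' * ∑ k ∈ Finset.range α, ‖u‖ ^ k) with hI
  have hA'0 : 0 ≤ A' := le_max_right _ _
  have hI0 : 0 ≤ I := integral_nonneg fun u => by positivity
  refine ⟨I + C, by positivity, fun z hz h h0 h1 => ?_⟩
  have hmeas : AEStronglyMeasurable
      (fun u => |K u| * |marginalZ f (z + h • u) - marginalZ f z|) volume := by
    refine (hK.measurable.abs.mul (Measurable.abs (Measurable.sub_const ?_ _))).aestronglyMeasurable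
    exact hf.contDiff.continuous.measurable.comp (by fun_prop)
  have hle : ∫⁻ u, ‖|K u| * |marginalZ f (z + h • u) - marginalZ f z|‖ₑ ≤
      ENNReal.ofReal ((I + C) * h) := by
    calc ∫⁻ u, ‖|K u| * |marginalZ f (z + h • u) - marginalZ f z|‖ₑ
        ≤ ∫⁻ u, ENNReal.ofReal h * (ENNReal.ofReal (|K u| * (A' * ∑ k ∈ Finset.range α, ‖u‖ ^ k)) +
            ‖K u‖ₑ * ∑ i : Fin α → Fin p, ‖∏ l, u (i l)‖ₑ *
              ⨆ t ∈ Icc (0 : ℝ) 1, ‖partialDeriv α i (marginalZ f) (z + t • u)‖ₑ) := by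
          refine lintegral_mono fun u => ?_
          have h2 := enorm_sub_le_of_contDiff hα hf.contDiff (z := z) (A := A')
            (fun k hk => (hA z hz k hk).trans (le_max_left _ _)) u h0 h1
          rw [enorm_mul, ← Real.norm_eq_abs, ← Real.norm_eq_abs, enorm_norm, enorm_norm]
          refine (mul_le_mul_right h2 ‖K u‖ₑ).trans (le_of_eq ?_)
          rw [ENNReal.ofReal_mul (norm_nonneg _), ofReal_norm]
          ring
      _ = ENNReal.ofReal h * (ENNReal.ofReal I +
            ∫⁻ u, ‖K u‖ₑ * ∑ i : Fin α → Fin p, ‖∏ l, u (i l)‖ₑ *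
              ⨆ t ∈ Icc (0 : ℝ) 1, ‖partialDeriv α i (marginalZ f) (z + t • u)‖ₑ) := by
          -- These forms ask for no measurability of the supremum over `t`, only of the polynomial
          -- part.
          rw [lintegral_const_mul' _ _ ENNReal.ofReal_ne_top, lintegral_add_left',
            ofReal_integral_eq_lintegral_ofReal hpoly (ae_of_all _ fun u => by positivity)]
          exact hpoly.aestronglyMeasurable.aemeasurable.ennreal_ofReal
      _ ≤ ENNReal.ofReal h * (ENNReal.ofReal I + ENNReal.ofReal C) := by
          gcongr
          exact hC z hz
      _ = ENNReal.ofReal ((I + C) * h) := by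
          rw [← ENNReal.ofReal_add hI0 hC0.le, ← ENNReal.ofReal_mul h0, mul_comm]
  refine ⟨⟨hmeas, hle.trans_lt ENNReal.ofReal_lt_top⟩, ?_⟩
  rw [integral_eq_lintegral_of_nonneg_ae (ae_of_all _ fun u => by positivity) hmeas]
  refine ENNReal.toReal_le_of_le_ofReal (by positivity) (le_trans (le_of_eq ?_) hle)
  refine lintegral_congr fun u => ?_
  rw [Real.enorm_eq_ofReal (by positivity)]

end Taylor

/-! ### Bilinear integrals of product densities -/

section Bilinear

variable {E : Type*} [MeasurableSpace E] {μ : Measure E}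

lemma integrable_bilinear {G : E × E → ℝ} (hG : Measurable G) {B : ℝ} (hB : ∀ q, |G q| ≤ B)
    {a b : E → ℝ} (ha : Integrable a μ) (hb : Integrable b μ) :
    Integrable (fun q : E × E => G q * (a q.1 * b q.2)) (μ.prod μ) :=
  (ha.mul_prod hb).bdd_mul hG.aestronglyMeasurable (ae_of_all _ hB)

variable [SFinite μ]

/-- The bilinear integral against a bounded kernel is continuous in `L¹`. -/
lemma abs_bilinear_sub_le {G : E × E → ℝ} (hG : Measurable G) {B : ℝ} (hB : ∀ q, |G q| ≤ B)
    {a b : E → ℝ} (ha : Integrable a μ) (hb : Integrable b μ) :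
    |∫ q, G q * (a q.1 * a q.2) ∂(μ.prod μ) - ∫ q, G q * (b q.1 * b q.2) ∂(μ.prod μ)| ≤
      B * ((∫ e, |a e - b e| ∂μ) * (∫ e, |a e| ∂μ + ∫ e, |b e| ∂μ)) := by
  have hd := (ha.sub hb).abs
  have i1 := hd.mul_prod ha.abs
  have i2 := hb.abs.mul_prod hd
  have hB0 : ∀ q : E × E, 0 ≤ B := fun q => (abs_nonneg _).trans (hB q)
  rw [← integral_sub (integrable_bilinear hG hB ha ha) (integrable_bilinear hG hB hb hb)]
  have e1 : ∫ q : E × E, (|(a - b) q.1| * |a q.2| + |b q.1| * |(a - b) q.2|) ∂(μ.prod μ) =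
      (∫ e, |a e - b e| ∂μ) * (∫ e, |a e| ∂μ + ∫ e, |b e| ∂μ) := by
    rw [integral_add i1 i2, integral_prod_mul (fun e => |(a - b) e|) fun e => |a e|,
      integral_prod_mul (fun e => |b e|) fun e => |(a - b) e|]
    simp only [Pi.sub_apply]
    ring
  rw [← e1, ← integral_const_mul]
  refine norm_integral_le_of_norm_le (f := fun q : E × E => G q * (a q.1 * a q.2) -
    G q * (b q.1 * b q.2)) ((i1.add i2).const_mul B) (ae_of_all _ fun q => ?_)
  rw [← mul_sub, norm_mul, Real.norm_eq_abs, Real.norm_eq_abs]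
  refine mul_le_mul (hB q) ?_ (abs_nonneg _) (hB0 q)
  -- Telescoping: `a ⊗ a - b ⊗ b = (a - b) ⊗ a + b ⊗ (a - b)`.
  have : a q.1 * a q.2 - b q.1 * b q.2 =
      (a - b) q.1 * a q.2 + b q.1 * (a - b) q.2 := by
    simp only [Pi.sub_apply]; ring
  rw [this]
  refine (abs_add_le _ _).trans (le_of_eq ?_)
  simp only [abs_mul]

/-- Integrals with respect to the square of a law with a density. -/
lemma integral_prod_withDensity {d : E → ℝ} (hd : Measurable d) (hd0 : ∀ e, 0 ≤ d e)
    (φ : E × E → ℝ) :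
    ∫ q, φ q ∂((μ.withDensity fun e => ENNReal.ofReal (d e)).prod
        (μ.withDensity fun e => ENNReal.ofReal (d e))) =
      ∫ q, φ q * (d q.1 * d q.2) ∂(μ.prod μ) := by
  rw [prod_withDensity hd.ennreal_ofReal hd.ennreal_ofReal,
    integral_withDensity_eq_integral_toReal_smul (by fun_prop)
      (ae_of_all _ fun q => ENNReal.mul_lt_top ENNReal.ofReal_lt_top ENNReal.ofReal_lt_top)]
  refine integral_congr_ae (ae_of_all _ fun q => ?_)
  simp only [ENNReal.toReal_mul, ENNReal.toReal_ofReal (hd0 _), smul_eq_mul]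
  ring

/-- By Fubini, since `G` ignores the `Y` coordinates. With `∫ k = 1` it puts `pairLimit` in the same
bilinear form as the mean of the U-statistic, so that `abs_bilinear_sub_le` compares them. -/
lemma integral_bilinear_tensor {X Y : Type*} [MeasurableSpace X] [MeasurableSpace Y]
    {lX : Measure X} {lY : Measure Y} [SFinite lX] [SFinite lY]
    {G : X × X → ℝ} (hG : Measurable G) {B : ℝ} (hB : ∀ q, |G q| ≤ B)
    {u : X → ℝ} {k : Y → ℝ} (hu : Integrable u lX) (hk : Integrable k lY) :
    ∫ q : (X × Y) × (X × Y), G (q.1.1, q.2.1) * ((u q.1.1 * k q.1.2) * (u q.2.1 * k q.2.2))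
        ∂((lX.prod lY).prod (lX.prod lY)) =
      (∫ y, k y ∂lY) ^ 2 * ∫ r, G r * (u r.1 * u r.2) ∂(lX.prod lX) := by
  have huk := hu.mul_prod hk
  have hint : Integrable (fun q : (X × Y) × (X × Y) =>
      G (q.1.1, q.2.1) * ((u q.1.1 * k q.1.2) * (u q.2.1 * k q.2.2)))
      ((lX.prod lY).prod (lX.prod lY)) :=
    integrable_bilinear (G := fun q : (X × Y) × (X × Y) => G (q.1.1, q.2.1))
      (hG.comp (by fun_prop)) (fun q => hB _) huk huk
  rw [integral_prod _ hint, integral_prod _ (integrable_bilinear hG hB hu hu)]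
  have h1 : ∀ e : X × Y, ∫ e' : X × Y,
      G (e.1, e'.1) * ((u e.1 * k e.2) * (u e'.1 * k e'.2)) ∂(lX.prod lY) =
      (∫ x', G (e.1, x') * (u e.1 * u x') ∂lX) * (k e.2 * ∫ y, k y ∂lY) := by
    intro e
    rw [← integral_const_mul (k e.2), ← integral_prod_mul]
    exact integral_congr_ae (ae_of_all _ fun e' => by ring)
  simp_rw [h1]
  rw [integral_prod_mul (fun x => ∫ x', G (x, x') * (u x * u x') ∂lX)
    (fun y => k y * ∫ y, k y ∂lY), integral_mul_const]
  ring

end Bilinear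

/-! ### Rescaled kernels -/

section Kernel

variable {p : ℕ}

/-- Change of variables in a rescaled integral. -/
lemma integral_rescale {h : ℝ} (hh : 0 < h) (Ψ : (Fin p → ℝ) → ℝ) (z : Fin p → ℝ) :
    ∫ ζ, (h ^ p)⁻¹ * Ψ (h⁻¹ • (ζ - z)) = ∫ u, Ψ u := by
  rw [integral_const_mul, integral_sub_right_eq_self (fun ζ => Ψ (h⁻¹ • ζ)) z,
    Measure.integral_comp_inv_smul_of_nonneg volume Ψ hh.le]
  simp only [Module.finrank_fin_fun, smul_eq_mul]
  rw [inv_mul_cancel_left₀ (pow_pos hh p).ne']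

lemma integral_abs_scaledKernel_mul (K : (Fin p → ℝ) → ℝ) {h : ℝ} (hh : 0 < h)
    (N : (Fin p → ℝ) → ℝ) (z : Fin p → ℝ) :
    ∫ ζ, |scaledKernel K h (ζ - z)| * N ζ = ∫ u, |K u| * N (z + h • u) := by
  rw [← integral_rescale hh (fun u => |K u| * N (z + h • u)) z]
  refine integral_congr_ae (ae_of_all _ fun ζ => ?_)
  simp only [scaledKernel, smul_smul, mul_inv_cancel₀ hh.ne', one_smul, add_sub_cancel, abs_mul,
    abs_of_pos (inv_pos.2 (pow_pos hh p)), mul_assoc]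

lemma integral_scaledKernel (K : (Fin p → ℝ) → ℝ) {h : ℝ} (hh : 0 < h) (z : Fin p → ℝ) :
    ∫ ζ, scaledKernel K h (ζ - z) = ∫ u, K u := integral_rescale hh K z

lemma measurable_scaledKernel {K : (Fin p → ℝ) → ℝ} (hK : Measurable K) (h : ℝ) :
    Measurable (scaledKernel K h) := by
  unfold scaledKernel
  exact (hK.comp (by fun_prop)).const_mul _

lemma integrable_scaledKernel {K : (Fin p → ℝ) → ℝ} (hK : Integrable K) {h : ℝ} (hh : 0 < h)
    (z : Fin p → ℝ) : Integrable fun ζ => scaledKernel K h (ζ - z) := by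
  have h1 : Integrable fun ζ => K (h⁻¹ • ζ) := hK.comp_smul (inv_ne_zero hh.ne')
  exact (h1.const_mul (h ^ p)⁻¹).comp_sub_right z

lemma abs_scaledKernel_le {K : (Fin p → ℝ) → ℝ} {C : ℝ} (hC : ∀ u, |K u| ≤ C) {h : ℝ} (hh : 0 < h)
    (u : Fin p → ℝ) : |scaledKernel K h u| ≤ (h ^ p)⁻¹ * C := by
  rw [scaledKernel, abs_mul, abs_of_pos (inv_pos.2 (pow_pos hh p))]
  exact mul_le_mul_of_nonneg_left (hC _) (inv_pos.2 (pow_pos hh p)).le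

end Kernel

/-! ### Continuity of the sections of the joint density in `L¹` -/

section Sections

variable {p : ℕ} {f : ℝ × ℝ → (Fin p → ℝ) → ℝ}

/-- A Bochner integral that is not zero can only come from an integrable function. -/
lemma integrable_section_of_pos {z : Fin p → ℝ} (hz : 0 < marginalZ f z) :
    Integrable fun x => f x z := by
  by_contra h
  rw [marginalZ, integral_undef h] at hz
  exact lt_irrefl _ hz

/-- The mass of the section at `z` that is missing in the section at `w`. -/
noncomputable def deficit (f : ℝ × ℝ → (Fin p → ℝ) → ℝ) (z w : Fin p → ℝ) : ℝ := ∫ x, max (f x z - f x w) 0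

lemma measurable_section (hm : Measurable (Function.uncurry f)) (z : Fin p → ℝ) :
    Measurable fun x => f x z := hm.comp (measurable_id.prodMk measurable_const)

lemma max_sub_le_section (hf0 : ∀ x z, 0 ≤ f x z) (z w : Fin p → ℝ) (x : ℝ × ℝ) :
    max (f x z - f x w) 0 ≤ f x z :=
  max_le (by linarith [hf0 x w]) (hf0 x z)

/-- The deficit is dominated by the section at `z` alone. This is why it is preferred to the `L¹`
distance: the point `w` may leave `𝒵`, where the section need not be known integrable. -/
lemma integrable_deficit (hm : Measurable (Function.uncurry f)) (hf0 : ∀ x z, 0 ≤ f x z)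
    {z : Fin p → ℝ} (hz : Integrable fun x => f x z) (w : Fin p → ℝ) :
    Integrable fun x => max (f x z - f x w) 0 := by
  refine hz.mono' (((measurable_section hm z).sub
    (measurable_section hm w)).max measurable_const).aestronglyMeasurable (ae_of_all _ fun x => ?_)
  rw [Real.norm_of_nonneg (le_max_right _ _)]
  exact max_sub_le_section hf0 z w x

lemma deficit_nonneg (z w : Fin p → ℝ) : 0 ≤ deficit f z w :=
  integral_nonneg fun _ => le_max_right _ _

lemma deficit_le_marginal (hm : Measurable (Function.uncurry f)) (hf0 : ∀ x z, 0 ≤ f x z)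
    {z : Fin p → ℝ} (hz : Integrable fun x => f x z) (w : Fin p → ℝ) :
    deficit f z w ≤ marginalZ f z :=
  integral_mono (integrable_deficit hm hf0 hz w) hz (max_sub_le_section hf0 z w)

lemma measurable_deficit (hm : Measurable (Function.uncurry f)) (z : Fin p → ℝ) :
    Measurable (deficit f z) := by
  have : StronglyMeasurable fun w => ∫ x, max (f x z - f x w) 0 := by
    refine StronglyMeasurable.integral_prod_right' (f := fun q : (Fin p → ℝ) × (ℝ × ℝ) =>
      max (f q.2 z - f q.2 q.1) 0) ?_
    refine Measurable.stronglyMeasurable (Measurable.max (Measurable.sub ?_ ?_) measurable_const)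
    · exact (measurable_section hm z).comp measurable_snd
    · exact hm.comp measurable_swap
  exact this.measurable

/-- Scheffé's lemma, for the deficit. -/
lemma tendsto_deficit (hm : Measurable (Function.uncurry f)) (hf0 : ∀ x z, 0 ≤ f x z)
    (hc : ∀ x, Continuous (f x)) {z : Fin p → ℝ} (hz : Integrable fun x => f x z) :
    Tendsto (deficit f z) (𝓝 z) (𝓝 0) := by
  have h0 : (0 : ℝ) = ∫ x : ℝ × ℝ, (0 : ℝ) := by simp
  rw [h0]
  refine tendsto_integral_filter_of_dominated_convergence (fun x => f x z)
    (Eventually.of_forall fun w => (integrable_deficit hm hf0 hz w).aestronglyMeasurable)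
    (Eventually.of_forall fun w => ae_of_all _ fun x => ?_) hz (ae_of_all _ fun x => ?_)
  · rw [Real.norm_of_nonneg (le_max_right _ _)]
    exact max_sub_le_section hf0 z w x
  · have : Continuous fun w => max (f x z - f x w) 0 :=
      (continuous_const.sub (hc x)).max continuous_const
    simpa using this.tendsto z

/-- The identity behind Scheffé's lemma: after integration, an `L¹` distance is a difference of
masses plus twice a deficit. -/
lemma abs_sub_eq_add_max (a b : ℝ) : |a - b| = a - b + 2 * max (b - a) 0 := by
  rcases le_total a b with h | h
  · rw [max_eq_left (by linarith), abs_of_nonpos (by linarith)]; ring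
  · rw [max_eq_right (by linarith), abs_of_nonneg (by linarith)]; ring

lemma integral_abs_section_sub (hm : Measurable (Function.uncurry f)) (hf0 : ∀ x z, 0 ≤ f x z)
    {z w : Fin p → ℝ} (hz : Integrable fun x => f x z) (hw : Integrable fun x => f x w) :
    ∫ x, |f x w - f x z| = marginalZ f w - marginalZ f z + 2 * deficit f z w := by
  simp_rw [abs_sub_eq_add_max]
  have e1 : ∫ x, (f x w - f x z + 2 * max (f x z - f x w) 0) =
      (∫ x, (f x w - f x z)) + ∫ x, 2 * max (f x z - f x w) 0 :=
    integral_add (hw.sub hz) ((integrable_deficit hm hf0 hz w).const_mul 2)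
  rw [e1, integral_sub hw hz, integral_const_mul]
  rfl

/-- Moves the base point from a variable `z` to a fixed `z₀`, where `tendsto_deficit` applies. -/
lemma deficit_le_add (hm : Measurable (Function.uncurry f)) (hf0 : ∀ x z, 0 ≤ f x z)
    {z z₀ : Fin p → ℝ} (hz : Integrable fun x => f x z) (hz₀ : Integrable fun x => f x z₀)
    (w : Fin p → ℝ) : deficit f z w ≤ (∫ x, |f x z - f x z₀|) + deficit f z₀ w := by
  unfold deficit
  have e1 : (∫ x, |f x z - f x z₀|) + ∫ x, max (f x z₀ - f x w) 0 =
      ∫ x, (|f x z - f x z₀| + max (f x z₀ - f x w) 0) :=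
    (integral_add (hz.sub hz₀).abs (integrable_deficit hm hf0 hz₀ w)).symm
  rw [e1]
  refine integral_mono (integrable_deficit hm hf0 hz w)
    ((hz.sub hz₀).abs.add (integrable_deficit hm hf0 hz₀ w)) fun x => ?_
  refine max_le ?_ (add_nonneg (abs_nonneg _) (le_max_right _ _))
  have h1 := le_abs_self (f x z - f x z₀)
  have h2 := le_max_left (f x z₀ - f x w) 0
  linarith

variable {𝒵 : Set (Fin p → ℝ)}

/-- The sections depend continuously on the point, in `L¹`. -/
lemma tendsto_integral_abs_section_sub (hm : Measurable (Function.uncurry f))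
    (hf0 : ∀ x z, 0 ≤ f x z) (hc : ∀ x, Continuous (f x)) (hF : Continuous (marginalZ f))
    (hpos : ∀ z ∈ 𝒵, 0 < marginalZ f z) {z₀ : Fin p → ℝ} (hz₀ : z₀ ∈ 𝒵) :
    Tendsto (fun z => ∫ x, |f x z - f x z₀|) (𝓝[𝒵] z₀) (𝓝 0) := by
  have hi := fun z hz => integrable_section_of_pos (hpos z hz)
  have h1 : Tendsto (fun z => marginalZ f z - marginalZ f z₀ + 2 * deficit f z₀ z) (𝓝 z₀)
      (𝓝 (marginalZ f z₀ - marginalZ f z₀ + 2 * 0)) :=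
    ((hF.tendsto z₀).sub_const _).add ((tendsto_deficit hm hf0 hc (hi z₀ hz₀)).const_mul 2)
  rw [sub_self, mul_zero, add_zero] at h1
  refine (h1.mono_left nhdsWithin_le_nhds).congr' ?_
  filter_upwards [self_mem_nhdsWithin] with z hz
  exact (integral_abs_section_sub hm hf0 (hi z₀ hz₀) (hi z hz)).symm

/-- The smoothed deficits vanish with the bandwidth, uniformly on a compact set. -/
lemma eventually_smoothed_deficit_lt (hm : Measurable (Function.uncurry f))
    (hf0 : ∀ x z, 0 ≤ f x z) (hc : ∀ x, Continuous (f x)) (hF : Continuous (marginalZ f))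
    (h𝒵 : IsCompact 𝒵) (hpos : ∀ z ∈ 𝒵, 0 < marginalZ f z) {fmax : ℝ}
    (hmax : ∀ z ∈ 𝒵, marginalZ f z ≤ fmax) {K : (Fin p → ℝ) → ℝ} (hK : Measurable K)
    (hKi : Integrable K) {ε : ℝ} (hε : 0 < ε) :
    ∀ᶠ h : ℝ in 𝓝 0, ∀ z ∈ 𝒵, ∫ u, |K u| * deficit f z (z + h • u) < ε := by
  have hi := fun z hz => integrable_section_of_pos (hpos z hz)
  -- Compactness reduces uniformity in `z` to a joint limit as `(h, z) → (0, z₀)` with `z` kept in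
  -- `𝒵`, which dominated convergence with majorant `|K| fmax` provides.
  suffices H : ∀ z₀ ∈ 𝒵, ∀ᶠ q : ℝ × (Fin p → ℝ) in 𝓝 (0, z₀),
      q.2 ∈ 𝒵 → ∫ u, |K u| * deficit f q.2 (q.2 + q.1 • u) < ε by
    have := h𝒵.eventually_forall_of_forall_eventually
      (P := fun h z => z ∈ 𝒵 → ∫ u, |K u| * deficit f z (z + h • u) < ε) H
    filter_upwards [this] with h hh z hz using hh z hz hz
  intro z₀ hz₀
  set ℱ : Filter (ℝ × (Fin p → ℝ)) := 𝓝 (0, z₀) ⊓ 𝓟 (Prod.snd ⁻¹' 𝒵) with hℱ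
  have hmem : ∀ᶠ q : ℝ × (Fin p → ℝ) in ℱ, q.2 ∈ 𝒵 :=
    mem_inf_of_right (mem_principal_self _)
  have hsnd : Tendsto Prod.snd ℱ (𝓝[𝒵] z₀) :=
    tendsto_nhdsWithin_iff.2 ⟨(continuous_snd.tendsto (0, z₀)).mono_left inf_le_left, hmem⟩
  have hlim : Tendsto (fun q : ℝ × (Fin p → ℝ) =>
      ∫ u, |K u| * deficit f q.2 (q.2 + q.1 • u)) ℱ (𝓝 0) := by
    have h0 : (0 : ℝ) = ∫ u : Fin p → ℝ, (0 : ℝ) := by simp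
    rw [h0]
    refine tendsto_integral_filter_of_dominated_convergence (fun u => |K u| * fmax)
      (Eventually.of_forall fun q => ?_) ?_ (hKi.abs.mul_const _) (ae_of_all _ fun u => ?_)
    · exact (hK.abs.mul ((measurable_deficit hm q.2).comp (by fun_prop))).aestronglyMeasurable
    · filter_upwards [hmem] with q hq
      refine ae_of_all _ fun u => ?_
      rw [Real.norm_of_nonneg (mul_nonneg (abs_nonneg _) (deficit_nonneg _ _))]
      exact mul_le_mul_of_nonneg_left
        ((deficit_le_marginal hm hf0 (hi _ hq) _).trans (hmax _ hq)) (abs_nonneg _)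
    · have hle : ∀ᶠ q : ℝ × (Fin p → ℝ) in ℱ, deficit f q.2 (q.2 + q.1 • u) ≤
          (∫ x, |f x q.2 - f x z₀|) + deficit f z₀ (q.2 + q.1 • u) := by
        filter_upwards [hmem] with q hq
        exact deficit_le_add hm hf0 (hi _ hq) (hi _ hz₀) _
      have t1 : Tendsto (fun q : ℝ × (Fin p → ℝ) => ∫ x, |f x q.2 - f x z₀|) ℱ (𝓝 0) :=
        (tendsto_integral_abs_section_sub hm hf0 hc hF hpos hz₀).comp hsnd
      have t2 : Tendsto (fun q : ℝ × (Fin p → ℝ) => q.2 + q.1 • u) ℱ (𝓝 z₀) := by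
        have : Continuous fun q : ℝ × (Fin p → ℝ) => q.2 + q.1 • u := by fun_prop
        have h3 := this.tendsto (0, z₀)
        simp only [zero_smul, add_zero] at h3
        exact h3.mono_left inf_le_left
      have t3 := t1.add ((tendsto_deficit hm hf0 hc (hi _ hz₀)).comp t2)
      rw [add_zero] at t3
      have t4 : Tendsto (fun q : ℝ × (Fin p → ℝ) => deficit f q.2 (q.2 + q.1 • u)) ℱ (𝓝 0) :=
        tendsto_of_tendsto_of_tendsto_of_le_of_le' tendsto_const_nhds t3
          (Eventually.of_forall fun q => deficit_nonneg _ _) hle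
      simpa using t4.const_mul |K u|
  have hev := hlim.eventually (gt_mem_nhds hε)
  rw [hℱ, eventually_inf_principal] at hev
  exact hev

end Sections

/-! ### Bias of the U-statistics as the bandwidth vanishes -/

section Bias

variable {p : ℕ} {f : ℝ × ℝ → (Fin p → ℝ) → ℝ}

/-- The law on `ℝ² × ℝᵖ` with density `f`. -/
noncomputable def jointLaw (f : ℝ × ℝ → (Fin p → ℝ) → ℝ) : Measure ((ℝ × ℝ) × (Fin p → ℝ)) :=
  volume.withDensity fun q => ENNReal.ofReal (f q.1 q.2)

/-- The kernel of the U-statistic in the numerator of the estimator. -/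
noncomputable def pairKernel (g : ℝ × ℝ → ℝ × ℝ → ℝ) (K : (Fin p → ℝ) → ℝ) (h : ℝ) (z : Fin p → ℝ)
    (q : ((ℝ × ℝ) × (Fin p → ℝ)) × ((ℝ × ℝ) × (Fin p → ℝ))) : ℝ :=
  scaledKernel K h (q.1.2 - z) * scaledKernel K h (q.2.2 - z) * g q.1.1 q.2.1

/-- The limit of the mean of the U-statistic. -/
noncomputable def pairLimit (g : ℝ × ℝ → ℝ × ℝ → ℝ) (f : ℝ × ℝ → (Fin p → ℝ) → ℝ)
    (z : Fin p → ℝ) : ℝ :=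
  ∫ r : (ℝ × ℝ) × (ℝ × ℝ), g r.1 r.2 * (f r.1 z * f r.2 z)

/-- The smoothed density is close in `L¹` to the section times the rescaled kernel. -/
lemma integral_abs_smoothed_sub (hm : Measurable (Function.uncurry f)) (hf0 : ∀ x z, 0 ≤ f x z)
    (hfi : Integrable fun e : (ℝ × ℝ) × (Fin p → ℝ) => f e.1 e.2)
    {K : (Fin p → ℝ) → ℝ} (hK : Measurable K) (hKi : Integrable K) {C : ℝ}
    (hKC : ∀ u, |K u| ≤ C) {z : Fin p → ℝ} (hz : Integrable fun x => f x z) {h : ℝ} (hh : 0 < h)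
    (hinc : Integrable fun u => |K u| * |marginalZ f (z + h • u) - marginalZ f z|) :
    ∫ e : (ℝ × ℝ) × (Fin p → ℝ), |f e.1 e.2 * scaledKernel K h (e.2 - z)
        - f e.1 z * scaledKernel K h (e.2 - z)| ≤
      (∫ u, |K u| * |marginalZ f (z + h • u) - marginalZ f z|)
        + 2 * ∫ u, |K u| * deficit f z (z + h • u) := by
  set k : (Fin p → ℝ) → ℝ := fun ζ => |scaledKernel K h (ζ - z)| with hk
  have hkm : Measurable k := ((measurable_scaledKernel hK h).comp (by fun_prop)).abs
  have hki : Integrable k := (integrable_scaledKernel hKi hh z).abs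
  have hkC : ∀ ζ, ‖k ζ‖ ≤ (h ^ p)⁻¹ * C := fun ζ => by
    rw [hk, Real.norm_eq_abs, abs_abs]
    exact abs_scaledKernel_le hKC hh _
  have i1 : Integrable fun e : (ℝ × ℝ) × (Fin p → ℝ) => k e.2 * f e.1 e.2 :=
    hfi.bdd_mul (hkm.comp measurable_snd).aestronglyMeasurable (ae_of_all _ fun e => hkC e.2)
  have i2 : Integrable fun e : (ℝ × ℝ) × (Fin p → ℝ) => k e.2 * f e.1 z := by
    exact (hz.mul_prod hki).congr (ae_of_all _ fun e => mul_comm _ _)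
  have i3 : Integrable fun e : (ℝ × ℝ) × (Fin p → ℝ) =>
      k e.2 * max (f e.1 z - f e.1 e.2) 0 := by
    refine i2.mono' (Measurable.aestronglyMeasurable ?_) (ae_of_all _ fun e => ?_)
    · exact (hkm.comp measurable_snd).mul
        ((((measurable_section hm z).comp measurable_fst).sub hm).max measurable_const)
    · have hk0 : 0 ≤ k e.2 := abs_nonneg _
      rw [Real.norm_of_nonneg (mul_nonneg hk0 (le_max_right _ _))]
      exact mul_le_mul_of_nonneg_left (max_sub_le_section hf0 z e.2 e.1) hk0
  -- Scheffé's identity, weighted by the kernel; integrating in `x` first turns the three terms into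
  -- `marginalZ` and `deficit`.
  have hpt : ∀ e : (ℝ × ℝ) × (Fin p → ℝ), |f e.1 e.2 * scaledKernel K h (e.2 - z)
        - f e.1 z * scaledKernel K h (e.2 - z)| =
      (k e.2 * f e.1 e.2 - k e.2 * f e.1 z) + 2 * (k e.2 * max (f e.1 z - f e.1 e.2) 0) := by
    intro e
    rw [← sub_mul, abs_mul, abs_sub_eq_add_max]
    simp only [hk]
    ring
  simp_rw [hpt]
  have e0 : ∫ e : (ℝ × ℝ) × (Fin p → ℝ), ((k e.2 * f e.1 e.2 - k e.2 * f e.1 z)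
        + 2 * (k e.2 * max (f e.1 z - f e.1 e.2) 0)) =
      (∫ e : (ℝ × ℝ) × (Fin p → ℝ), (k e.2 * f e.1 e.2 - k e.2 * f e.1 z)) +
      ∫ e : (ℝ × ℝ) × (Fin p → ℝ), 2 * (k e.2 * max (f e.1 z - f e.1 e.2) 0) :=
    integral_add (i1.sub i2) (i3.const_mul 2)
  have f1 : ∫ e : (ℝ × ℝ) × (Fin p → ℝ), k e.2 * f e.1 e.2 =
      ∫ u, |K u| * marginalZ f (z + h • u) := by
    rw [← integral_abs_scaledKernel_mul K hh, Measure.volume_eq_prod, integral_prod_symm _ i1]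
    simp only [integral_const_mul]
    rfl
  have f2 : ∫ e : (ℝ × ℝ) × (Fin p → ℝ), k e.2 * f e.1 z = ∫ u, |K u| * marginalZ f z := by
    rw [← integral_abs_scaledKernel_mul K hh (fun _ => marginalZ f z), Measure.volume_eq_prod,
      integral_prod_symm _ i2]
    simp only [integral_const_mul]
    rfl
  have f3 : ∫ e : (ℝ × ℝ) × (Fin p → ℝ), k e.2 * max (f e.1 z - f e.1 e.2) 0 =
      ∫ u, |K u| * deficit f z (z + h • u) := by
    rw [← integral_abs_scaledKernel_mul K hh, Measure.volume_eq_prod, integral_prod_symm _ i3]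
    simp only [integral_const_mul]
    rfl
  have hinc' : Integrable fun u => |K u| * (marginalZ f (z + h • u) - marginalZ f z) := by
    have hFm : Measurable (marginalZ f) := by
      have : StronglyMeasurable fun w => ∫ x, f x w :=
        StronglyMeasurable.integral_prod_right' (f := fun q : (Fin p → ℝ) × (ℝ × ℝ) => f q.2 q.1)
          (hm.comp measurable_swap).stronglyMeasurable
      exact this.measurable
    refine hinc.mono' ?_ (ae_of_all _ fun u => ?_)
    · exact (hK.abs.mul ((hFm.comp (by fun_prop)).sub_const _)).aestronglyMeasurable
    · rw [norm_mul, Real.norm_eq_abs, Real.norm_eq_abs, abs_abs]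
  have hFz : Integrable fun u => |K u| * marginalZ f z := hKi.abs.mul_const _
  have hFh : Integrable fun u => |K u| * marginalZ f (z + h • u) := by
    refine (hinc'.add hFz).congr (ae_of_all _ fun u => ?_)
    simp only [Pi.add_apply]
    ring
  rw [e0, integral_sub i1 i2, integral_const_mul, f1, f2, f3, ← integral_sub hFh hFz]
  refine add_le_add_left (integral_mono (hFh.sub hFz) hinc fun u => ?_) _
  simp only [Pi.sub_apply]
  rw [← mul_sub]
  exact mul_le_mul_of_nonneg_left (le_abs_self _) (abs_nonneg _)

lemma measurable_density (hm : Measurable (Function.uncurry f)) :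
    Measurable fun e : (ℝ × ℝ) × (Fin p → ℝ) => f e.1 e.2 := hm

/-- The mean of the U-statistic kernel converges as the bandwidth vanishes, uniformly on a compact
set; the smoothed density stays bounded in `L¹`. -/
lemma eventually_abs_integral_pairKernel_sub_le (hm : Measurable (Function.uncurry f))
    (hf0 : ∀ x z, 0 ≤ f x z)
    (hfi : Integrable fun e : (ℝ × ℝ) × (Fin p → ℝ) => f e.1 e.2) {𝒵 : Set (Fin p → ℝ)}
    (h𝒵 : IsCompact 𝒵) {K : (Fin p → ℝ) → ℝ} {α : ℕ} (hK : IsKernelOfOrder K α)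
    (hfZ : MarginalSmooth f K α 𝒵) (hc : ∀ x, Continuous (f x))
    (hpos : ∀ z ∈ 𝒵, 0 < marginalZ f z) {fmax : ℝ} (hmax : ∀ z ∈ 𝒵, marginalZ f z ≤ fmax) :
    ∃ A : ℝ, 0 < A ∧ ∀ ε > 0, ∀ᶠ h : ℝ in 𝓝[>] 0, ∀ z ∈ 𝒵,
      (∫ e, |scaledKernel K h (e.2 - z)| ∂(jointLaw f)) ≤ A ∧
      ∀ (g : ℝ × ℝ → ℝ × ℝ → ℝ) (B : ℝ), Measurable (Function.uncurry g) →
        (∀ x y, |g x y| ≤ B) →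
        |∫ q, pairKernel g K h z q ∂((jointLaw f).prod (jointLaw f)) - pairLimit g f z| ≤
          B * ε := by
  obtain ⟨CK, hCK⟩ := hK.bounded
  obtain ⟨C, hC0, hC⟩ := hfZ.exists_smoothed_increment_le h𝒵 hK
  set J := ∫ u, |K u| with hJ
  have hJ0 : 0 ≤ J := integral_nonneg fun _ => abs_nonneg _
  set A := |fmax| * J + 1 with hA
  have hA0 : 0 < A := by positivity
  refine ⟨A, hA0, fun ε hε => ?_⟩
  -- `δ ≤ 1` keeps the `L¹` norm of the smoothed density below `A`; the second bound gives `δ * (A +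
  -- A) ≤ ε` in the bilinear estimate. The distance `δ` is spent as `δ / 2` on the increment and
  -- twice `δ / 4` on the deficit.
  set δ := min 1 (ε / (2 * A)) with hδ
  have hδ0 : 0 < δ := by positivity
  have hδε : δ * (A + A) ≤ ε := by
    have : δ ≤ ε / (2 * A) := min_le_right _ _
    rw [le_div_iff₀ (by positivity)] at this
    linarith
  have ev1 : ∀ᶠ h : ℝ in 𝓝 0, C * h < δ / 2 := by
    have : Tendsto (fun h : ℝ => C * h) (𝓝 0) (𝓝 (C * 0)) := tendsto_id.const_mul C
    rw [mul_zero] at this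
    exact this.eventually (gt_mem_nhds (by positivity))
  have ev2 := eventually_smoothed_deficit_lt hm hf0 hc hfZ.contDiff.continuous h𝒵 hpos hmax
    hK.measurable hK.integrable (show (0 : ℝ) < δ / 4 by positivity)
  have ev3 : ∀ᶠ h : ℝ in 𝓝 0, h < 1 := gt_mem_nhds one_pos
  filter_upwards [nhdsWithin_le_nhds ev1, nhdsWithin_le_nhds ev2, nhdsWithin_le_nhds ev3,
    self_mem_nhdsWithin] with h h1 h2 h3 h4 z hz
  have hh : 0 < h := h4
  have hzi := integrable_section_of_pos (hpos z hz)
  obtain ⟨hinc, hincle⟩ := hC z hz h hh.le h3.le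
  set a : (ℝ × ℝ) × (Fin p → ℝ) → ℝ := fun e => f e.1 e.2 * scaledKernel K h (e.2 - z) with ha
  set b : (ℝ × ℝ) × (Fin p → ℝ) → ℝ := fun e => f e.1 z * scaledKernel K h (e.2 - z) with hb
  have hab : ∫ e, |a e - b e| ≤ δ := by
    have := integral_abs_smoothed_sub hm hf0 hfi hK.measurable hK.integrable hCK hzi hh hinc
    have h5 := h2 z hz
    linarith
  have hkm : Measurable fun e : (ℝ × ℝ) × (Fin p → ℝ) => scaledKernel K h (e.2 - z) :=
    (measurable_scaledKernel hK.measurable h).comp (by fun_prop)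
  have hai : Integrable a :=
    hfi.mul_bdd hkm.aestronglyMeasurable (ae_of_all _ fun e => abs_scaledKernel_le hCK hh _)
  have hbi : Integrable b := hzi.mul_prod (integrable_scaledKernel hK.integrable hh z)
  have hbn : ∫ e, |b e| = marginalZ f z * J := by
    have e1 : ∀ e, |b e| = f e.1 z * |scaledKernel K h (e.2 - z)| := fun e => by
      rw [hb, abs_mul, abs_of_nonneg (hf0 _ _)]
    have e2 := integral_abs_scaledKernel_mul K hh (fun _ => (1 : ℝ)) z
    simp only [mul_one] at e2
    simp_rw [e1]
    rw [Measure.volume_eq_prod, integral_prod_mul (fun x => f x z)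
      (fun ζ => |scaledKernel K h (ζ - z)|), e2]
    rfl
  have hbA : ∫ e, |b e| ≤ |fmax| * J := by
    rw [hbn]
    exact mul_le_mul_of_nonneg_right ((hmax z hz).trans (le_abs_self _)) hJ0
  have haA : ∫ e, |a e| ≤ A := by
    have : ∫ e, |a e| ≤ (∫ e, |a e - b e|) + ∫ e, |b e| := by
      have e1 : (∫ e, |a e - b e|) + ∫ e, |b e| = ∫ e, (|a e - b e| + |b e|) :=
        (integral_add (hai.sub hbi).abs hbi.abs).symm
      rw [e1]
      refine integral_mono hai.abs ((hai.sub hbi).abs.add hbi.abs) fun e => ?_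
      simpa using abs_add_le (a e - b e) (b e)
    have hδ1 : δ ≤ 1 := min_le_left _ _
    linarith
  refine ⟨?_, fun g B hg hB => ?_⟩
  · rw [jointLaw, integral_withDensity_eq_integral_toReal_smul
      (measurable_density hm).ennreal_ofReal (ae_of_all _ fun e => ENNReal.ofReal_lt_top)]
    refine le_trans (le_of_eq (integral_congr_ae (ae_of_all _ fun e => ?_))) haA
    simp only [ENNReal.toReal_ofReal (hf0 _ _), smul_eq_mul, ha, abs_mul, abs_of_nonneg (hf0 _ _)]
  · set G : ((ℝ × ℝ) × (Fin p → ℝ)) × ((ℝ × ℝ) × (Fin p → ℝ)) → ℝ :=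
      fun q => g q.1.1 q.2.1 with hG
    have hGm : Measurable G := hg.comp
      (f := fun q : ((ℝ × ℝ) × (Fin p → ℝ)) × ((ℝ × ℝ) × (Fin p → ℝ)) => (q.1.1, q.2.1))
      (by fun_prop)
    have e1 : ∫ q, pairKernel g K h z q ∂((jointLaw f).prod (jointLaw f)) =
        ∫ q, G q * (a q.1 * a q.2) := by
      rw [jointLaw, integral_prod_withDensity (measurable_density hm) (fun e => hf0 _ _)]
      refine integral_congr_ae (ae_of_all _ fun q => ?_)
      simp only [pairKernel, hG, ha]
      ring
    have e2 : pairLimit g f z = ∫ q, G q * (b q.1 * b q.2) := by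
      have := integral_bilinear_tensor (lX := (volume : Measure (ℝ × ℝ)))
        (lY := (volume : Measure (Fin p → ℝ))) hg (B := B) (fun q => hB _ _) hzi
        (integrable_scaledKernel hK.integrable hh z)
      rw [integral_scaledKernel K hh z, hK.integral_eq_one, one_pow, one_mul] at this
      exact this.symm
    rw [e1, e2]
    have hB0 : 0 ≤ B := (abs_nonneg _).trans (hB 0 0)
    refine (abs_bilinear_sub_le hGm (fun q => hB _ _) hai hbi).trans
      (mul_le_mul_of_nonneg_left ?_ hB0)
    refine le_trans (mul_le_mul hab (add_le_add haA (hbA.trans (by linarith)))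
      (add_nonneg (integral_nonneg fun _ => abs_nonneg _) (integral_nonneg fun _ => abs_nonneg _))
      hδ0.le) hδε

end Bias

/-! ### The kernels and the conditional Kendall's tau -/

section Kernels

variable {p : ℕ} {f : ℝ × ℝ → (Fin p → ℝ) → ℝ}

lemma measurable_kernel {g : ℝ × ℝ → ℝ × ℝ → ℝ} (hg : g = g₁ ∨ g = g₂ ∨ g = g₃) :
    Measurable (Function.uncurry g) := by
  classical
  rcases hg with rfl | rfl | rfl
  · exact (Measurable.ite measurableSet_lowerPairs measurable_const
      measurable_const).const_mul 4 |>.sub_const 1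
  · exact (Measurable.ite measurableSet_concordant measurable_const measurable_const).sub
      (Measurable.ite measurableSet_discordant measurable_const measurable_const)
  · exact ((Measurable.ite measurableSet_crossPairs measurable_const
      measurable_const).const_mul 4).const_sub 1

lemma abs_kernel_le {g : ℝ × ℝ → ℝ × ℝ → ℝ} (hg : g = g₁ ∨ g = g₂ ∨ g = g₃) (x y : ℝ × ℝ) :
    |g x y| ≤ 3 := by
  rcases hg with rfl | rfl | rfl
  · unfold g₁; split_ifs <;> norm_num
  · unfold g₂; split_ifs <;> norm_num
  · unfold g₃; split_ifs <;> norm_num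

/-- The denominator of the estimator is the V-statistic with `g = 1`; this is its limit. -/
lemma pairLimit_one (f : ℝ × ℝ → (Fin p → ℝ) → ℝ) (z : Fin p → ℝ) :
    pairLimit (fun _ _ => 1) f z = marginalZ f z ^ 2 := by
  unfold pairLimit marginalZ
  simp only [one_mul]
  rw [Measure.volume_eq_prod, integral_prod_mul (fun x => f x z) (fun x => f x z), sq]

lemma isProbabilityMeasure_condLaw (hf0 : ∀ x z, 0 ≤ f x z) {z : Fin p → ℝ}
    (hz : 0 < marginalZ f z) : IsProbabilityMeasure (condLaw f z) := by
  refine ⟨?_⟩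
  rw [condLaw, withDensity_apply _ MeasurableSet.univ, Measure.restrict_univ,
    ← ofReal_integral_eq_lintegral_ofReal ((integrable_section_of_pos hz).div_const _)
      (ae_of_all _ fun x => div_nonneg (hf0 x z) hz.le), integral_div]
  change ENNReal.ofReal (marginalZ f z / marginalZ f z) = 1
  rw [div_self hz.ne', ENNReal.ofReal_one]

lemma condTau_mem_Ioo (hm : Measurable (Function.uncurry f)) (hf0 : ∀ x z, 0 ≤ f x z)
    {z : Fin p → ℝ} (hz : 0 < marginalZ f z) : condTau f z ∈ Ioo (-1 : ℝ) 1 := by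
  have := isProbabilityMeasure_condLaw hf0 hz
  unfold condLaw at this
  exact tau_mem_Ioo (r := fun x => ENNReal.ofReal (f x z / marginalZ f z))
    ((measurable_section hm z).div_const _).ennreal_ofReal

/-- The limit of the normalised U-statistic is the conditional Kendall's tau. -/
lemma pairLimit_eq_condTau (hm : Measurable (Function.uncurry f)) (hf0 : ∀ x z, 0 ≤ f x z)
    {z : Fin p → ℝ} (hz : 0 < marginalZ f z) {g : ℝ × ℝ → ℝ × ℝ → ℝ}
    (hg : g = g₁ ∨ g = g₂ ∨ g = g₃) :
    pairLimit g f z = marginalZ f z ^ 2 * condTau f z := by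
  have := isProbabilityMeasure_condLaw hf0 hz
  have h1 : condTau f z = ∫ q, g q.1 q.2 ∂((condLaw f z).prod (condLaw f z)) :=
    (integral_kernel_eq (ν := condLaw f z) (withDensity_absolutelyContinuous _ _) hg).symm
  rw [h1, condLaw, integral_prod_withDensity ((measurable_section hm z).div_const _)
    (fun x => div_nonneg (hf0 x z) hz.le), ← integral_const_mul, pairLimit]
  refine integral_congr_ae (ae_of_all _ fun r => ?_)
  simp only
  field_simp

/-- The conditional tau is `pairLimit g₂ f / marginalZ f ^ 2`, whose numerator is continuous because
the sections are so in `L¹`. It serves to make the range over `𝒵` compact. -/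
lemma continuousOn_condTau (hm : Measurable (Function.uncurry f)) (hf0 : ∀ x z, 0 ≤ f x z)
    (hc : ∀ x, Continuous (f x)) (hF : Continuous (marginalZ f)) {𝒵 : Set (Fin p → ℝ)}
    (hpos : ∀ z ∈ 𝒵, 0 < marginalZ f z) : ContinuousOn (condTau f) 𝒵 := by
  have hg : g₂ = g₁ ∨ g₂ = g₂ ∨ g₂ = g₃ := Or.inr (Or.inl rfl)
  have hlim : ContinuousOn (pairLimit g₂ f) 𝒵 := by
    intro z₀ hz₀
    have hb : ∀ᶠ z in 𝓝[𝒵] z₀, |pairLimit g₂ f z - pairLimit g₂ f z₀| ≤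
        3 * ((∫ x, |f x z - f x z₀|) * (marginalZ f z + marginalZ f z₀)) := by
      filter_upwards [self_mem_nhdsWithin] with z hz
      have := abs_bilinear_sub_le (measurable_kernel hg) (B := 3)
        (fun q => abs_kernel_le hg q.1 q.2) (integrable_section_of_pos (hpos z hz))
        (integrable_section_of_pos (hpos z₀ hz₀))
      simp only [abs_of_nonneg (hf0 _ _)] at this
      exact this
    have ht : Tendsto (fun z => 3 * ((∫ x, |f x z - f x z₀|) * (marginalZ f z + marginalZ f z₀)))
        (𝓝[𝒵] z₀) (𝓝 (3 * (0 * (marginalZ f z₀ + marginalZ f z₀)))) :=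
      ((tendsto_integral_abs_section_sub hm hf0 hc hF hpos hz₀).mul
        (((hF.tendsto z₀).mono_left nhdsWithin_le_nhds).add_const _)).const_mul 3
    rw [zero_mul, mul_zero] at ht
    exact tendsto_iff_dist_tendsto_zero.2 (squeeze_zero' (Eventually.of_forall fun _ => dist_nonneg)
      hb ht)
  refine (hlim.div ((hF.pow 2).continuousOn) fun z hz => (pow_pos (hpos z hz) 2).ne').congr
    fun z hz => ?_
  rw [Pi.div_apply, Pi.pow_apply, pairLimit_eq_condTau hm hf0 (hpos z hz) hg, mul_div_cancel_left₀]
  exact (pow_pos (hpos z hz) 2).ne'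

end Kernels

/-! ### Concentration of the estimator -/

section Concentration

variable {p : ℕ}

/-- The complete average of `F` over `Fin n × Fin n` (a V-statistic). -/
noncomputable def fullMean {n : ℕ} (F : Fin n → Fin n → ℝ) : ℝ :=
  ((n : ℝ) ^ 2)⁻¹ * ∑ i, ∑ j, F i j

/-- The diagonal contributes at most `b / n`, and the change of normalisation from `n (n - 1)` to
`n²` another `b / n`. -/
lemma abs_fullMean_sub_pairMean_le {n : ℕ} (hn : 2 ≤ n) {F : Fin n → Fin n → ℝ} {b : ℝ}
    (hb : ∀ i j, |F i j| ≤ b) : |fullMean F - pairMean F| ≤ 2 * b / n := by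
  have hn0 : (0 : ℝ) < n := by positivity
  have hn1 : (0 : ℝ) < n - 1 := by
    have : (2 : ℝ) ≤ n := by exact_mod_cast hn
    linarith
  have hcard : ((Finset.univ : Finset (Fin n)).offDiag.card : ℝ) = n * (n - 1) := by
    rw [Finset.offDiag_card, Finset.card_univ, Fintype.card_fin, Nat.cast_sub (Nat.le_mul_self n)]
    push_cast
    ring
  have hsplit : ∑ i, ∑ j, F i j = ∑ i, F i i +
      ∑ q ∈ (Finset.univ : Finset (Fin n)).offDiag, F q.1 q.2 := by
    rw [← Finset.sum_product', ← Finset.diag_union_offDiag,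
      Finset.sum_union (Finset.disjoint_diag_offDiag _), Finset.sum_diag]
  set D := ∑ i, F i i with hD
  set O := ∑ q ∈ (Finset.univ : Finset (Fin n)).offDiag, F q.1 q.2 with hO
  have hDb : |D| ≤ n * b := by
    refine (Finset.abs_sum_le_sum_abs _ _).trans ((Finset.sum_le_sum fun i _ => hb i i).trans ?_)
    simp
  have hOb : |O| ≤ n * (n - 1) * b := by
    refine (Finset.abs_sum_le_sum_abs _ _).trans
      ((Finset.sum_le_sum fun q _ => hb q.1 q.2).trans ?_)
    rw [Finset.sum_const, nsmul_eq_mul, hcard]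
  have he : fullMean F - pairMean F = D / n ^ 2 - O / (n ^ 2 * (n - 1)) := by
    rw [fullMean, pairMean, hsplit, hcard, ← hO]
    field_simp
    ring
  rw [he]
  have h1 : |D / n ^ 2| ≤ b / n := by
    rw [abs_div, abs_of_pos (by positivity : (0 : ℝ) < n ^ 2), div_le_div_iff₀ (by positivity) hn0]
    nlinarith
  have h2 : |O / (n ^ 2 * (n - 1))| ≤ b / n := by
    rw [abs_div, abs_of_pos (by positivity : (0 : ℝ) < n ^ 2 * (n - 1)),
      div_le_div_iff₀ (by positivity) hn0]
    nlinarith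
  calc |D / n ^ 2 - O / (n ^ 2 * (n - 1))| ≤ b / n + b / n :=
        (abs_sub _ _).trans (add_le_add h1 h2)
    _ = 2 * b / n := by ring

/-- The estimator is a quotient of two V-statistics. -/
lemma tauHat_eq_div {n : ℕ} (hn : 0 < n) (g : ℝ × ℝ → ℝ × ℝ → ℝ) (K : (Fin p → ℝ) → ℝ) (h : ℝ)
    (X : ℕ → ℝ × ℝ) (Z : ℕ → Fin p → ℝ) (z : Fin p → ℝ) :
    tauHat g K h n X Z z =
      fullMean (fun i j : Fin n => pairKernel g K h z ((X i, Z i), (X j, Z j))) /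
      fullMean (fun i j : Fin n => pairKernel (fun _ _ => 1) K h z ((X i, Z i), (X j, Z j))) := by
  have hn0 : ((n : ℝ) ^ 2)⁻¹ ≠ 0 := by positivity
  simp only [fullMean, pairKernel, mul_one]
  rw [mul_div_mul_left _ _ hn0]
  set S := ∑ j ∈ Finset.range n, scaledKernel K h (Z j - z) with hS
  have hden : ∑ i : Fin n, ∑ j : Fin n, scaledKernel K h (Z i - z) * scaledKernel K h (Z j - z) =
      S * S := by
    rw [← Finset.sum_mul_sum, hS, Finset.sum_range]
  rw [hden, tauHat, Finset.sum_range, Finset.sum_div]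
  refine Finset.sum_congr rfl fun i _ => ?_
  rw [Finset.sum_range, Finset.sum_div]
  refine Finset.sum_congr rfl fun j _ => ?_
  -- The identity also holds for `S = 0`, both sides being zero by convention.
  simp only [weight, ← hS]
  ring

variable {f : ℝ × ℝ → (Fin p → ℝ) → ℝ}

lemma measurable_pairKernel {g : ℝ × ℝ → ℝ × ℝ → ℝ} (hg : Measurable (Function.uncurry g))
    {K : (Fin p → ℝ) → ℝ} (hK : Measurable K) (h : ℝ) (z : Fin p → ℝ) :
    Measurable (pairKernel g K h z) := by
  unfold pairKernel
  refine Measurable.mul (Measurable.mul ?_ ?_) ?_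
  · exact (measurable_scaledKernel hK h).comp (by fun_prop)
  · exact (measurable_scaledKernel hK h).comp (by fun_prop)
  · exact hg.comp
      (f := fun q : ((ℝ × ℝ) × (Fin p → ℝ)) × ((ℝ × ℝ) × (Fin p → ℝ)) => (q.1.1, q.2.1))
      (by fun_prop)

lemma abs_pairKernel_le {g : ℝ × ℝ → ℝ × ℝ → ℝ} (hg : ∀ x y, |g x y| ≤ 3)
    {K : (Fin p → ℝ) → ℝ} {C : ℝ} (hC : ∀ u, |K u| ≤ C) {h : ℝ} (hh : 0 < h) (z : Fin p → ℝ)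
    (q : ((ℝ × ℝ) × (Fin p → ℝ)) × ((ℝ × ℝ) × (Fin p → ℝ))) :
    |pairKernel g K h z q| ≤ 3 * ((h ^ p)⁻¹ * C) ^ 2 := by
  have hc := fun u => abs_scaledKernel_le hC hh u
  have hc0 : 0 ≤ (h ^ p)⁻¹ * C := (abs_nonneg _).trans (hc 0)
  rw [pairKernel, abs_mul, abs_mul]
  calc _ ≤ ((h ^ p)⁻¹ * C) * ((h ^ p)⁻¹ * C) * 3 := by
        gcongr
        · exact hc _
        · exact hc _
        · exact hg _ _
    _ = _ := by ring

/-- In each squared kernel one factor is bounded by its supremum `C / h ^ p` and the other kept in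
`L¹`, where `A` does not depend on `h`. The result is `O(h^{-2p})`, against `O(h^{-4p})` from the
sup norm alone. -/
lemma integral_pairKernel_sq_le [IsProbabilityMeasure (jointLaw f)] {g : ℝ × ℝ → ℝ × ℝ → ℝ}
    (hg : ∀ x y, |g x y| ≤ 3)
    {K : (Fin p → ℝ) → ℝ} (hK : Measurable K) {C : ℝ} (hC : ∀ u, |K u| ≤ C) {h : ℝ} (hh : 0 < h)
    (z : Fin p → ℝ) {A : ℝ} (hA : ∫ e, |scaledKernel K h (e.2 - z)| ∂(jointLaw f) ≤ A) :
    ∫ q, pairKernel g K h z q ^ 2 ∂((jointLaw f).prod (jointLaw f)) ≤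
      9 * ((h ^ p)⁻¹ * C) ^ 2 * A ^ 2 := by
  set c := (h ^ p)⁻¹ * C with hcdef
  have hc : ∀ u, |scaledKernel K h u| ≤ c := fun u => abs_scaledKernel_le hC hh u
  have hc0 : 0 ≤ c := (abs_nonneg _).trans (hc 0)
  set k : (ℝ × ℝ) × (Fin p → ℝ) → ℝ := fun e => |scaledKernel K h (e.2 - z)| with hk
  have hki : Integrable k (jointLaw f) := by
    refine Integrable.of_bound (C := c) ?_ (ae_of_all _ fun e => ?_)
    · exact ((measurable_scaledKernel hK h).comp (by fun_prop)).abs.aestronglyMeasurable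
    · rw [hk, Real.norm_eq_abs, abs_abs]; exact hc _
  have hi : Integrable (fun q => 9 * c ^ 2 * (k q.1 * k q.2))
      ((jointLaw f).prod (jointLaw f)) := (hki.mul_prod hki).const_mul _
  calc ∫ q, pairKernel g K h z q ^ 2 ∂((jointLaw f).prod (jointLaw f))
      ≤ ∫ q, 9 * c ^ 2 * (k q.1 * k q.2) ∂((jointLaw f).prod (jointLaw f)) := by
        refine integral_mono_of_nonneg (ae_of_all _ fun q => sq_nonneg _) hi
          (ae_of_all _ fun q => ?_)
        have h1 : pairKernel g K h z q ^ 2 = k q.1 ^ 2 * k q.2 ^ 2 * |g q.1.1 q.2.1| ^ 2 := by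
          simp only [pairKernel, hk, sq_abs]; ring
        have h2 : k q.1 ^ 2 ≤ c * k q.1 := by
          rw [sq]; exact mul_le_mul_of_nonneg_right (hc _) (abs_nonneg _)
        have h3 : k q.2 ^ 2 ≤ c * k q.2 := by
          rw [sq]; exact mul_le_mul_of_nonneg_right (hc _) (abs_nonneg _)
        have h4 : |g q.1.1 q.2.1| ^ 2 ≤ 3 ^ 2 := pow_le_pow_left₀ (abs_nonneg _) (hg _ _) 2
        have hk0 : ∀ e, 0 ≤ k e := fun e => abs_nonneg _
        simp only [h1]
        calc k q.1 ^ 2 * k q.2 ^ 2 * |g q.1.1 q.2.1| ^ 2 ≤ (c * k q.1) * (c * k q.2) * 3 ^ 2 :=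
              mul_le_mul (mul_le_mul h2 h3 (sq_nonneg _) (mul_nonneg hc0 (hk0 _))) h4
                (sq_nonneg _) (mul_nonneg (mul_nonneg hc0 (hk0 _)) (mul_nonneg hc0 (hk0 _)))
          _ = 9 * c ^ 2 * (k q.1 * k q.2) := by ring
    _ = 9 * c ^ 2 * (∫ e, k e ∂(jointLaw f)) ^ 2 := by
        rw [integral_const_mul, integral_prod_mul k k, sq (∫ e, k e ∂(jointLaw f))]
    _ ≤ 9 * c ^ 2 * A ^ 2 := by
        gcongr

/-- Exponential concentration of the U-statistics around their means, at a rate uniform in the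
bandwidth and in the point. -/
lemma exists_measure_pairMean_pairKernel_le {Ω : Type*} [MeasurableSpace Ω] {P : Measure Ω}
    [IsProbabilityMeasure P] [IsProbabilityMeasure (jointLaw f)]
    {ξ : ℕ → Ω → (ℝ × ℝ) × (Fin p → ℝ)} (hξm : ∀ i, Measurable (ξ i)) (hξ : iIndepFun ξ P)
    (hlaw : ∀ i, P.map (ξ i) = jointLaw f) {K : (Fin p → ℝ) → ℝ} (hK : Measurable K) {C : ℝ}
    (hC0 : 0 < C) (hC : ∀ u, |K u| ≤ C) {A : ℝ} (hA0 : 0 < A) {t : ℝ} (ht : 0 < t) :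
    ∃ a > 0, ∀ (g : ℝ × ℝ → ℝ × ℝ → ℝ), Measurable (Function.uncurry g) →
      (∀ x y, |g x y| ≤ 3) → ∀ (n : ℕ) (h : ℝ) (z : Fin p → ℝ), 2 ≤ n → 0 < h →
      (∫ e, |scaledKernel K h (e.2 - z)| ∂(jointLaw f)) ≤ A →
      P.real {ω | t ≤ |pairMean (fun i j : Fin n => pairKernel g K h z (ξ i ω, ξ j ω)) -
        ∫ q, pairKernel g K h z q ∂((jointLaw f).prod (jointLaw f))|} ≤
      2 * Real.exp (-a * n * h ^ (2 * p)) := by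
  -- With `s = θ h^{2p}`, the first bound gives `s * (2 * b) ≤ 1` and the second makes the variance
  -- term at most half of `s * t`. The exponent `n / 4 * (s * t / 2)` then yields the rate `θ * t /
  -- 8`.
  set θ := min (1 / (6 * C ^ 2)) (t / (18 * C ^ 2 * A ^ 2)) with hθ
  have hθ0 : 0 < θ := by positivity
  have hθ1 : θ * (6 * C ^ 2) ≤ 1 := (le_div_iff₀ (by positivity)).1 (min_le_left _ _)
  have hθ2 : θ * (18 * C ^ 2 * A ^ 2) ≤ t := (le_div_iff₀ (by positivity)).1 (min_le_right _ _)
  refine ⟨θ * t / 8, by positivity, fun g hg hg3 n h z hn hh hA => ?_⟩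
  have hp0 : 0 < h ^ p := pow_pos hh p
  have hp2 : h ^ (2 * p) = h ^ p * h ^ p := by rw [two_mul, pow_add]
  set s := θ * h ^ (2 * p) with hs
  have hs0 : 0 ≤ s := by positivity
  have e1 : s * (2 * (3 * ((h ^ p)⁻¹ * C) ^ 2)) = θ * (6 * C ^ 2) := by
    rw [hs, hp2]; field_simp; ring
  have e2 : s ^ 2 * (9 * ((h ^ p)⁻¹ * C) ^ 2 * A ^ 2) =
      θ * h ^ (2 * p) * (θ * (18 * C ^ 2 * A ^ 2) / 2) := by
    rw [hs, hp2]; field_simp; ring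
  have e3 : θ * h ^ (2 * p) * (t / 2) ≤
      s * t - s ^ 2 * (9 * ((h ^ p)⁻¹ * C) ^ 2 * A ^ 2) := by
    rw [e2, hs, ← mul_sub]
    exact mul_le_mul_of_nonneg_left (by linarith) (by positivity)
  refine (measure_pairMean_sub_ge_le hn hξm hξ hlaw (measurable_pairKernel hg hK h z)
    (abs_pairKernel_le hg3 hC hh z) (integral_pairKernel_sq_le hg3 hK hC hh z hA) hs0
    (e1.le.trans hθ1) (le_trans (by positivity) e3)).trans ?_
  gcongr
  have h5 := mul_le_mul_of_nonneg_left e3 (by positivity : (0 : ℝ) ≤ n / 4)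
  calc _ ≤ -(n / 4 * (θ * h ^ (2 * p) * (t / 2))) := neg_le_neg h5
    _ = _ := by ring

/-- A quotient is close to a ratio when numerator and denominator are close to their limits. -/
lemma abs_div_sub_le {V W F τ m ε : ℝ} (hm : 0 < m) (hF : m ≤ F) (hτ : |τ| ≤ 1)
    (hε : ε ≤ m ^ 2 / 2) (hV : |V - F ^ 2 * τ| ≤ ε) (hW : |W - F ^ 2| ≤ ε) :
    |V / W - τ| ≤ 4 * ε / m ^ 2 := by
  have hm2 : m ^ 2 ≤ F ^ 2 := pow_le_pow_left₀ hm.le hF 2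
  -- The denominator stays away from zero, at half the least possible limit.
  have hW0 : m ^ 2 / 2 ≤ W := by linarith [(abs_le.1 hW).1]
  have hWpos : 0 < W := lt_of_lt_of_le (by positivity) hW0
  have h1 : V / W - τ = ((V - F ^ 2 * τ) - τ * (W - F ^ 2)) / W := by
    field_simp; ring
  have hε0 : 0 ≤ ε := (abs_nonneg _).trans hV
  have h2 : |(V - F ^ 2 * τ) - τ * (W - F ^ 2)| ≤ 2 * ε := by
    refine (abs_sub _ _).trans ?_
    rw [abs_mul]
    have := mul_le_mul hτ hW (abs_nonneg _) zero_le_one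
    linarith
  rw [h1, abs_div, abs_of_pos hWpos, div_le_div_iff₀ hWpos (by positivity)]
  have h3 : |(V - F ^ 2 * τ) - τ * (W - F ^ 2)| * m ^ 2 ≤ 2 * ε * m ^ 2 :=
    mul_le_mul_of_nonneg_right h2 (by positivity)
  nlinarith

end Concentration

/-! ### Uniform concentration of the estimator and consistency of the two-step procedure -/

section Consistency

variable {p : ℕ} {f : ℝ × ℝ → (Fin p → ℝ) → ℝ}

/-- The rate condition forces the effective sample size to infinity. -/
lemma tendsto_effective_sample_size {ℓ : Filter (ℕ × ℕ)} (hℓ : ℓ ≤ atTop) {h : ℕ × ℕ → ℝ}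
    (hrate : ∀ A : ℝ, 0 < A →
      Tendsto (fun q : ℕ × ℕ => (q.2 : ℝ) * Real.exp (-A * q.1 * h q ^ (2 * p))) ℓ (𝓝 0)) :
    Tendsto (fun q : ℕ × ℕ => (q.1 : ℝ) * h q ^ (2 * p)) ℓ atTop := by
  have h1 := hrate 1 one_pos
  have hev : ∀ᶠ q : ℕ × ℕ in ℓ, 1 ≤ q.2 :=
    hℓ ((eventually_ge_atTop ((0, 1) : ℕ × ℕ)).mono fun q hq => hq.2)
  have h2 : Tendsto (fun q : ℕ × ℕ => Real.exp (-(q.1 * h q ^ (2 * p)))) ℓ (𝓝 0) := by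
    refine squeeze_zero' (Eventually.of_forall fun q => (Real.exp_pos _).le) ?_ h1
    filter_upwards [hev] with q hq
    have : -1 * (q.1 : ℝ) * h q ^ (2 * p) = -(q.1 * h q ^ (2 * p)) := by ring
    rw [this]
    exact le_mul_of_one_le_left (Real.exp_pos _).le (by exact_mod_cast hq)
  exact tendsto_neg_atBot_iff.1 (Real.tendsto_exp_comp_nhds_zero.1 h2)

/-- A link that is continuous on `(-1, 1)` is uniformly continuous near a compact subset. -/
lemma exists_pos_forall_abs_sub_le {T : Set ℝ} (hT : IsCompact T) {L : ℝ → ℝ}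
    (hL : ∀ a ∈ T, ContinuousAt L a) {η : ℝ} (hη : 0 < η) :
    ∃ ρ > 0, ∀ a ∈ T, ∀ t, |t - a| ≤ ρ → |L t - L a| ≤ η := by
  have h1 := hT.uniformContinuousAt_of_continuousAt L hL (Metric.dist_mem_uniformity hη)
  obtain ⟨ρ, hρ, h2⟩ := Metric.mem_uniformity_dist.1 h1
  refine ⟨ρ / 2, by positivity, fun a ha t ht => ?_⟩
  have h3 : dist a t < ρ := by
    rw [dist_comm, Real.dist_eq]; linarith
  have h4 := h2 h3 ha
  rw [mem_ofPred_eq, dist_comm, Real.dist_eq] at h4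
  exact h4.le

variable {Ω : Type*} [MeasurableSpace Ω] {P : Measure Ω}
  {X : ℕ → Ω → ℝ × ℝ} {Z : ℕ → Ω → Fin p → ℝ}

lemma IsSample.map_eq_jointLaw (hs : IsSample P f X Z) (i : ℕ) :
    P.map (fun ω => (X i ω, Z i ω)) = jointLaw f := hs.law i

variable [IsProbabilityMeasure P]

lemma IsSample.isProbabilityMeasure_jointLaw (hs : IsSample P f X Z) :
    IsProbabilityMeasure (jointLaw f) := by
  rw [← hs.map_eq_jointLaw 0]
  exact Measure.isProbabilityMeasure_map
    ((hs.measurable_X 0).prodMk (hs.measurable_Z 0)).aemeasurable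

lemma IsSample.integrable_density (hs : IsSample P f X Z) :
    Integrable fun e : (ℝ × ℝ) × (Fin p → ℝ) => f e.1 e.2 := by
  have h1 : jointLaw f univ = 1 := hs.isProbabilityMeasure_jointLaw.measure_univ
  rw [jointLaw, withDensity_apply _ MeasurableSet.univ, Measure.restrict_univ] at h1
  refine ⟨(measurable_density hs.density_measurable).aestronglyMeasurable, ?_⟩
  rw [hasFiniteIntegral_iff_ofReal (ae_of_all _ fun e => hs.density_nonneg _ _), h1]
  exact ENNReal.one_lt_top

/-- Uniform exponential concentration of the estimator of the conditional Kendall's tau. -/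
lemma exists_eventually_measure_tauHat_le (hs : IsSample P f X Z) {𝒵 : Set (Fin p → ℝ)}
    (h𝒵 : IsCompact 𝒵) {g : ℝ × ℝ → ℝ × ℝ → ℝ} (hg : g = g₁ ∨ g = g₂ ∨ g = g₃)
    {K : (Fin p → ℝ) → ℝ} {α : ℕ} (hK : IsKernelOfOrder K α) (hfZ : MarginalSmooth f K α 𝒵)
    (hc : ∀ x, Continuous (f x)) {fmin fmax : ℝ} (hmin0 : 0 < fmin)
    (hb : ∀ z ∈ 𝒵, fmin ≤ marginalZ f z ∧ marginalZ f z ≤ fmax)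
    {ℓ : Filter (ℕ × ℕ)} (hℓ : ℓ ≤ atTop)
    {h : ℕ × ℕ → ℝ} (hpos : ∀ q, 0 < h q) (hlim : Tendsto h ℓ (𝓝 0))
    (hrate : ∀ A : ℝ, 0 < A →
      Tendsto (fun q : ℕ × ℕ => (q.2 : ℝ) * Real.exp (-A * q.1 * h q ^ (2 * p))) ℓ (𝓝 0))
    {ρ : ℝ} (hρ : 0 < ρ) :
    ∃ a > 0, ∀ᶠ q in ℓ, ∀ z ∈ 𝒵,
      P.real {ω | ρ < |tauHat g K (h q) q.1 (fun j => X j ω) (fun j => Z j ω) z - condTau f z|} ≤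
        4 * Real.exp (-a * q.1 * h q ^ (2 * p)) := by
  have hm := hs.density_measurable
  have hf0 := hs.density_nonneg
  have := hs.isProbabilityMeasure_jointLaw
  have hFpos : ∀ z ∈ 𝒵, 0 < marginalZ f z := fun z hz => hmin0.trans_le (hb z hz).1
  obtain ⟨A, hA0, hbias⟩ := eventually_abs_integral_pairKernel_sub_le hm hf0
    hs.integrable_density h𝒵 hK hfZ hc hFpos fun z hz => (hb z hz).2
  obtain ⟨C₀, hC₀⟩ := hK.bounded
  set C := |C₀| + 1 with hCdef
  have hC0 : 0 < C := by positivity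
  have hC : ∀ u, |K u| ≤ C := fun u => (hC₀ u).trans (by linarith [le_abs_self C₀])
  -- Precision for numerator and denominator: the first bound keeps the denominator positive, the
  -- second makes the quotient error at most `ρ`.
  set ε := min (fmin ^ 2 / 2) (ρ * fmin ^ 2 / 4) with hε
  have hε0 : 0 < ε := by positivity
  have hερ : 4 * ε / fmin ^ 2 ≤ ρ := by
    rw [div_le_iff₀ (by positivity)]
    linarith [min_le_right (fmin ^ 2 / 2) (ρ * fmin ^ 2 / 4)]
  obtain ⟨a, ha0, htail⟩ := exists_measure_pairMean_pairKernel_le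
    (ξ := fun i ω => (X i ω, Z i ω)) (fun i => (hs.measurable_X i).prodMk (hs.measurable_Z i))
    hs.indep hs.map_eq_jointLaw hK.measurable hC0 hC hA0 (show 0 < ε / 3 by positivity)
  refine ⟨a, ha0, ?_⟩
  have hlim' : Tendsto h ℓ (𝓝[>] 0) :=
    tendsto_nhdsWithin_iff.2 ⟨hlim, Eventually.of_forall hpos⟩
  have hn : ∀ᶠ q : ℕ × ℕ in ℓ, 2 ≤ q.1 :=
    hℓ ((eventually_ge_atTop ((2, 0) : ℕ × ℕ)).mono fun q hq => hq.1)
  -- The budget `ε` splits into thirds: the deviation of the U-statistic, its bias `3 * (ε / 9)`,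
  -- and the passage from V- to U-statistic, `6 C² / (n h^{2p})`, small once the effective sample
  -- size exceeds this threshold.
  have heff := (tendsto_effective_sample_size hℓ hrate).eventually_ge_atTop (18 * C ^ 2 / ε)
  filter_upwards [hlim'.eventually (hbias (ε / 9) (by positivity)), hn, heff] with q hq hn2 hq2 z hz
  set n := q.1 with hndef
  have hh := hpos q
  obtain ⟨hA, hbz⟩ := hq z hz
  have hn0 : (0 : ℝ) < n := by positivity
  -- the deviation of a V-statistic
  have key : ∀ k : ℝ × ℝ → ℝ × ℝ → ℝ, Measurable (Function.uncurry k) → (∀ x y, |k x y| ≤ 3) →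
      P.real {ω | ε < |fullMean (fun i j : Fin n =>
        pairKernel k K (h q) z ((X i ω, Z i ω), (X j ω, Z j ω))) - pairLimit k f z|} ≤
      2 * Real.exp (-a * n * h q ^ (2 * p)) := by
    intro k hk hk3
    refine (measureReal_mono fun ω hω => ?_).trans (htail k hk hk3 n (h q) z hn2 hh hA)
    rw [mem_ofPred_eq] at hω ⊢
    have h1 := abs_fullMean_sub_pairMean_le hn2 (F := fun i j : Fin n =>
      pairKernel k K (h q) z ((X i ω, Z i ω), (X j ω, Z j ω)))
      fun i j => abs_pairKernel_le hk3 hC hh z _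
    have h2 : 2 * (3 * ((h q ^ p)⁻¹ * C) ^ 2) / n ≤ ε / 3 := by
      rw [div_le_iff₀ hε0] at hq2
      have hp0 : 0 < h q ^ p := pow_pos hh p
      have hp2 : h q ^ (2 * p) = h q ^ p * h q ^ p := by rw [two_mul, pow_add]
      have e1 : 2 * (3 * ((h q ^ p)⁻¹ * C) ^ 2) / n = 6 * C ^ 2 / (n * h q ^ (2 * p)) := by
        rw [hp2]; field_simp; norm_num
      rw [e1, div_le_iff₀ (by positivity)]
      linarith
    have h3 := hbz k 3 hk hk3
    by_contra hlt
    push Not at hlt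
    have h4 := abs_sub_le (fullMean fun i j : Fin n =>
      pairKernel k K (h q) z ((X i ω, Z i ω), (X j ω, Z j ω)))
      (pairMean fun i j : Fin n =>
      pairKernel k K (h q) z ((X i ω, Z i ω), (X j ω, Z j ω))) (pairLimit k f z)
    have h5 := abs_sub_le (pairMean fun i j : Fin n =>
      pairKernel k K (h q) z ((X i ω, Z i ω), (X j ω, Z j ω)))
      (∫ q', pairKernel k K (h q) z q' ∂((jointLaw f).prod (jointLaw f))) (pairLimit k f z)
    linarith
  have hkey1 := key g (measurable_kernel hg) (abs_kernel_le hg)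
  have hkey2 := key (fun _ _ => 1) measurable_const (fun _ _ => by norm_num)
  -- If neither numerator nor denominator deviates by more than `ε`, the quotient is within `ρ`; the
  -- two tails add up to the factor `4`.
  refine (measureReal_mono (s₂ := {ω | ε < |fullMean (fun i j : Fin n =>
        pairKernel g K (h q) z ((X i ω, Z i ω), (X j ω, Z j ω))) - pairLimit g f z|} ∪
      {ω | ε < |fullMean (fun i j : Fin n =>
        pairKernel (fun _ _ => 1) K (h q) z ((X i ω, Z i ω), (X j ω, Z j ω))) -
          pairLimit (fun _ _ => 1) f z|}) fun ω hω => ?_).trans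
    ((measureReal_union_le _ _).trans (by linarith))
  by_contra hnot
  simp only [mem_union, mem_ofPred_eq, not_or, not_lt] at hnot hω
  obtain ⟨h1, h2⟩ := hnot
  rw [pairLimit_eq_condTau hm hf0 (hFpos z hz) hg] at h1
  rw [pairLimit_one] at h2
  have hτ := condTau_mem_Ioo hm hf0 (hFpos z hz)
  have h3 := abs_div_sub_le hmin0 (hb z hz).1 (abs_le.2 ⟨hτ.1.le, hτ.2.le⟩) (min_le_left _ _) h1 h2
  rw [← tauHat_eq_div (by omega) g K (h q) (fun j => X j ω) (fun j => Z j ω) z] at h3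
  linarith

/-- Consistency of the two-step estimator at the unique minimizer of the limiting criterion. -/
lemma tendstoInMeasure_of_unique_minimizer {p' : ℕ} (hs : IsSample P f X Z)
    {𝒵 : Set (Fin p → ℝ)} (h𝒵 : IsCompact 𝒵) {g : ℝ × ℝ → ℝ × ℝ → ℝ}
    (hg : g = g₁ ∨ g = g₂ ∨ g = g₃) {K : (Fin p → ℝ) → ℝ} {α : ℕ} (hK : IsKernelOfOrder K α)
    (hfZ : MarginalSmooth f K α 𝒵) (hfZb : MarginalBounded f 𝒵) (hfXZ : JointSmooth f K α 𝒵)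
    {ψ : (Fin p → ℝ) → Fin p' → ℝ} {Lam : ℝ → ℝ} (hlink : LinkAssumption f ψ Lam 𝒵)
    {βstar : Fin p' → ℝ} (hmodel : ∀ z ∈ 𝒵, Lam (condTau f z) = ψ z ⬝ᵥ βstar)
    {z' : ℕ → Fin p → ℝ} (hz' : ∀ i, z' i ∈ 𝒵) {M : Matrix (Fin p') (Fin p') ℝ}
    (hM : Tendsto (gram ψ z') atTop (𝓝 M)) {ℓ : Filter (ℕ × ℕ)} (hℓ : ℓ ≤ atTop)
    {h : ℕ × ℕ → ℝ} (hpos : ∀ q, 0 < h q) (hlim : Tendsto h ℓ (𝓝 0))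
    {lam : ℕ × ℕ → ℝ} {lam₀ : ℝ} (hlam : ∀ q, 0 ≤ lam q) (hlamlim : Tendsto lam ℓ (𝓝 lam₀))
    (hrate : ∀ A : ℝ, 0 < A →
      Tendsto (fun q : ℕ × ℕ => (q.2 : ℝ) * Real.exp (-A * q.1 * h q ^ (2 * p))) ℓ (𝓝 0))
    {βhat : ℕ × ℕ → Ω → Fin p' → ℝ}
    (hβhat : ∀ q ω, IsMinOn
      (lassoCriterion ψ z' (fun i => Lam (tauHat g K (h q) q.1
          (fun j => X j ω) (fun j => Z j ω) (z' i))) q.2 (lam q)) univ (βhat q ω))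
    {b : Fin p' → ℝ}
    (hb : ∀ β, β ≠ b → limitCriterion M βstar lam₀ b < limitCriterion M βstar lam₀ β) :
    TendstoInMeasure P βhat ℓ (fun _ => b) := by
  have hm := hs.density_measurable
  have hf0 := hs.density_nonneg
  have hc : ∀ x, Continuous (f x) := fun x => (hfXZ.contDiff x).continuous
  obtain ⟨fmin, fmax, hmin0, -, hfb⟩ := hfZb
  have hFpos : ∀ z ∈ 𝒵, 0 < marginalZ f z := fun z hz => hmin0.trans_le (hfb z hz).1
  obtain ⟨C, hC⟩ := hlink.basis_bounded
  rw [tendstoInMeasure_iff_measureReal_dist]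
  intro ε hε
  obtain ⟨η, hη, hnear⟩ := exists_eventually_dist_lt (fun i j => hC _ (hz' i) j) hM hℓ hlam
    hlamlim hb hε
  have hT : IsCompact (condTau f '' 𝒵) :=
    h𝒵.image_of_continuousOn (continuousOn_condTau hm hf0 hc hfZ.contDiff.continuous hFpos)
  have hLc : ∀ a ∈ condTau f '' 𝒵, ContinuousAt Lam a := by
    rintro _ ⟨z, hz, rfl⟩
    exact hlink.contDiffOn.continuousOn.continuousAt
      (isOpen_Ioo.mem_nhds (condTau_mem_Ioo hm hf0 (hFpos z hz)))
  obtain ⟨ρ, hρ, hLρ⟩ := exists_pos_forall_abs_sub_le hT hLc hη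
  obtain ⟨a, ha, htail⟩ := exists_eventually_measure_tauHat_le hs h𝒵 hg hK hfZ hc hmin0 hfb hℓ
    hpos hlim hrate hρ
  have hup : Tendsto (fun q : ℕ × ℕ => 4 * ((q.2 : ℝ) * Real.exp (-a * q.1 * h q ^ (2 * p)))) ℓ
      (𝓝 0) := by
    simpa using (hrate a ha).const_mul 4
  refine squeeze_zero' (Eventually.of_forall fun q => measureReal_nonneg) ?_ hup
  filter_upwards [hnear, htail] with q hq1 hq2
  -- When every estimate at a design point is within `ρ`, all responses are within `η` of the model
  -- and the deterministic lemma applies to each minimizer.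
  have hsub : {ω | ε ≤ dist (βhat q ω) b} ⊆ ⋃ i ∈ Finset.range q.2,
      {ω | ρ < |tauHat g K (h q) q.1 (fun j => X j ω) (fun j => Z j ω) (z' i) -
        condTau f (z' i)|} := by
    intro ω hω
    by_contra hnot
    simp only [mem_iUnion, Finset.mem_range, mem_ofPred_eq, exists_prop, not_exists, not_and,
      not_lt] at hnot hω
    refine absurd (hq1 _ (fun i hi => ?_) _ (hβhat q ω)) (not_lt.2 hω)
    rw [← hmodel _ (hz' i)]
    exact hLρ _ (mem_image_of_mem _ (hz' i)) _ (hnot i hi)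
  -- Only monotonicity and subadditivity are used, so no measurable choice of the minimizer is
  -- needed. The rate `a` depends on `ε`, which is why the rate condition is asked for every `A`.
  calc P.real {ω | ε ≤ dist (βhat q ω) b}
      ≤ ∑ i ∈ Finset.range q.2, P.real {ω | ρ < |tauHat g K (h q) q.1 (fun j => X j ω)
          (fun j => Z j ω) (z' i) - condTau f (z' i)|} :=
        (measureReal_mono hsub (measure_ne_top _ _)).trans (measureReal_biUnion_finset_le _ _)
    _ ≤ ∑ _i ∈ Finset.range q.2, 4 * Real.exp (-a * q.1 * h q ^ (2 * p)) :=
        Finset.sum_le_sum fun i _ => hq2 _ (hz' i)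
    _ = 4 * ((q.2 : ℝ) * Real.exp (-a * q.1 * h q ^ (2 * p))) := by
        rw [Finset.sum_const, Finset.card_range, nsmul_eq_mul]; ring

end Consistency

end CondKendall

theorem mainTheorem6 {p p' : ℕ} {Ω : Type*} [MeasurableSpace Ω]
    (P : Measure Ω) [IsProbabilityMeasure P]
    -- the sample, its joint density, and the compact set of covariate values
    (f : ℝ × ℝ → (Fin p → ℝ) → ℝ)
    (X : ℕ → Ω → ℝ × ℝ) (Z : ℕ → Ω → Fin p → ℝ)
    (hsample : CondKendall.IsSample P f X Z)
    (𝒵 : Set (Fin p → ℝ)) (h𝒵 : IsCompact 𝒵)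
    -- the kernel estimator
    (g : ℝ × ℝ → ℝ × ℝ → ℝ)
    (hg : g = CondKendall.g₁ ∨ g = CondKendall.g₂ ∨ g = CondKendall.g₃)
    (K : (Fin p → ℝ) → ℝ) (α : ℕ)
    (hK : CondKendall.IsKernelOfOrder K α)
    (hfZ : CondKendall.MarginalSmooth f K α 𝒵)
    (hfZb : CondKendall.MarginalBounded f 𝒵)
    (hfXZ : CondKendall.JointSmooth f K α 𝒵)
    -- the regression model
    (ψ : (Fin p → ℝ) → Fin p' → ℝ) (Lam : ℝ → ℝ)
    (hlink : CondKendall.LinkAssumption f ψ Lam 𝒵)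
    (βstar : Fin p' → ℝ)
    (hmodel : ∀ z ∈ 𝒵, Lam (CondKendall.condTau f z) = ψ z ⬝ᵥ βstar)
    -- the design points
    (z' : ℕ → Fin p → ℝ) (hz' : ∀ i, z' i ∈ 𝒵)
    (M : Matrix (Fin p') (Fin p') ℝ)
    (hM : Tendsto (CondKendall.gram ψ z') atTop (𝓝 M))
    -- `(n, n') → ∞` along `ℓ`; for instance `ℓ` is the image of `atTop` under `n ↦ (n, n'(n))`
    (ℓ : Filter (ℕ × ℕ)) (hℓ : ℓ ≤ atTop)
    (h : ℕ × ℕ → ℝ) (hpos : ∀ q, 0 < h q) (hlim : Tendsto h ℓ (𝓝 0))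
    (lam : ℕ × ℕ → ℝ) (lam₀ : ℝ) (hlam : ∀ q, 0 ≤ lam q) (hlamlim : Tendsto lam ℓ (𝓝 lam₀))
    (hrate : ∀ A : ℝ, 0 < A →
      Tendsto (fun q : ℕ × ℕ => (q.2 : ℝ) * Real.exp (-A * q.1 * h q ^ (2 * p))) ℓ (𝓝 0))
    -- the two-step estimator: any minimizer of the penalized criterion
    (βhat : ℕ × ℕ → Ω → Fin p' → ℝ)
    (hβhat : ∀ q ω, IsMinOn
      (CondKendall.lassoCriterion ψ z'
        (fun i => Lam (CondKendall.tauHat g K (h q) q.1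
          (fun j => X j ω) (fun j => Z j ω) (z' i))) q.2 (lam q))
      univ (βhat q ω)) :
    (∀ b : Fin p' → ℝ,
      (∀ β, β ≠ b → CondKendall.limitCriterion M βstar lam₀ b <
        CondKendall.limitCriterion M βstar lam₀ β) →
      TendstoInMeasure P βhat ℓ (fun _ => b)) ∧
    (lam₀ = 0 → IsUnit M → TendstoInMeasure P βhat ℓ (fun _ => βstar)) := by
  have hfirst : ∀ b : Fin p' → ℝ,
      (∀ β, β ≠ b → CondKendall.limitCriterion M βstar lam₀ b <
        CondKendall.limitCriterion M βstar lam₀ β) →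
      TendstoInMeasure P βhat ℓ (fun _ => b) := fun b hb =>
    CondKendall.tendstoInMeasure_of_unique_minimizer hsample h𝒵 hg hK hfZ hfZb hfXZ hlink hmodel
      hz' hM hℓ hpos hlim hlam hlamlim hrate hβhat hb
  refine ⟨hfirst, fun h0 hunit => hfirst βstar fun β hβ => ?_⟩
  rw [h0]
  exact CondKendall.limitCriterion_lt_of_isUnit hM hunit hβ
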